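/- For $m\ge 0$ let $\mathcal O_m$ denote the real algebra of germs at $0$ of real analytic functions $\mathbb R^m\to\mathbb R$. Let $H:(\mathbb R^3,0)\to(\mathrm{Herm}(n),A_0)$ be a real analytic germ of Hermitian $n\times n$ matrices, and let $\lambda_0\in\mathbb R$ be a two-fold degenerate eigenvalue of $A_0=H(0)$, that is, an eigenvalue of multiplicity exactly $2$. Let $J\subset\mathcal O_4$ be the ideal generated by the $(n-1)\times(n-1)$ minors of $H(x,y,z)-(\lambda_0+\lambda)\mathbb 1$, a matrix in the variables $(x,y,z,\lambda)$. (These minors are complex valued and occur in complex conjugate pairs; the real ideal generated by them means the ideal generated by their real and imaginary parts.) An *effective germ* of $H$ at $\lambda_0$ is an analytic map germ $h=(h_1,h_2,h_3):(\mathbb R^3,0)\to(\mathbb R^3,0)$ obtained as follows from a Schrieffer–Wolff decomposition. Choose a unitary matrix $G_0$ with $$G_0^{-1}A_0G_0=A_0'=\begin{pmatrix}\lambda_0\mathbb 1_2&0\\0&\widetilde A_0\end{pmatrix},\qquad \widetilde A_0-\lambda_0\mathbb 1_{n-2}\ \text{invertible},$$ and write, for $p\in\mathbb R^3$ near $0$,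 $$H(p)=G_0\,e^{S(p)}\bigl(A_0'+C(p)+A_{\mathrm{eff}}(p)\bigr)e^{-S(p)}\,G_0^{-1},$$ where $S,C,A_{\mathrm{eff}}$ are analytic at $0$ and vanish at $0$, $S=\begin{pmatrix}0&S_{12}\\S_{21}&0\end{pmatrix}$ is anti-Hermitian, and $C=\begin{pmatrix}0&0\\0&C_{22}\end{pmatrix}$ and $A_{\mathrm{eff}}=\begin{pmatrix}\widetilde A_{\mathrm{eff}}&0\\0&0\end{pmatrix}$ are Hermitian, with blocks of sizes $2$ and $n-2$. Then $h_1,h_2,h_3$ are the coordinates of the traceless part $\widetilde A_{\mathrm{eff}}-\tfrac12\mathrm{tr}(\widetilde A_{\mathrm{eff}})\mathbb 1_2$ in a basis of the real $3$-dimensional space of traceless Hermitian $2\times2$ matrices. The *local algebra* of $h$ is $Q_0(h)=\mathcal O_3/(h_1,h_2,h_3)$. **Proposition.** An effective germ of $H$ at $\lambda_0$ exists, and for every effective germ $h$ of $H$ at $\lambda_0$ the real algebras $\mathcal O_4/J$ and $Q_0(h)$ are isomorphic. -/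

import Mathlib

open Filter Topology Matrix

noncomputable section

/-- The real algebra of functions `ℝᵐ → ℝ` that are real analytic at the origin. -/
def analyticFunctions (m : ℕ) : Subalgebra ℝ ((Fin m → ℝ) → ℝ) where
  carrier := {f | AnalyticAt ℝ f 0}
  mul_mem' hf hg := AnalyticAt.mul hf hg
  add_mem' hf hg := AnalyticAt.add hf hg
  algebraMap_mem' c := (analyticAt_const : AnalyticAt ℝ (fun _ : Fin m → ℝ => c) 0)

/-- The ideal of those functions that vanish on a neighbourhood of the origin. -/
def germwiseZero (m : ℕ) : Ideal (analyticFunctions m) where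
  carrier := {f | (f : (Fin m → ℝ) → ℝ) =ᶠ[𝓝 0] 0}
  zero_mem' := EventuallyEq.refl _ _
  add_mem' {f g} hf hg := by
    have h := EventuallyEq.add hf hg
    rw [add_zero] at h
    exact h
  smul_mem' c f hf := by
    have h := EventuallyEq.mul (EventuallyEq.refl (𝓝 0) (c : (Fin m → ℝ) → ℝ)) hf
    rw [mul_zero] at h
    exact h

/-- `𝒪ₘ`: the real algebra of germs at the origin of real analytic functions on `ℝᵐ`. -/
def AnalyticGerm (m : ℕ) : Type := analyticFunctions m ⧸ germwiseZero m

instance (m : ℕ) : CommRing (AnalyticGerm m) :=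
  inferInstanceAs (CommRing (analyticFunctions m ⧸ germwiseZero m))

instance (m : ℕ) : Algebra ℝ (AnalyticGerm m) :=
  inferInstanceAs (Algebra ℝ (analyticFunctions m ⧸ germwiseZero m))

/-- The germ at the origin of a function that is analytic there. -/
def AnalyticGerm.mk {m : ℕ} (f : (Fin m → ℝ) → ℝ) (hf : AnalyticAt ℝ f 0) : AnalyticGerm m :=
  Ideal.Quotient.mk (germwiseZero m) ⟨f, hf⟩

/-- `I_h`: the ideal of `𝒪ₘ` generated by the components of an analytic map germ `h`. -/
def componentIdeal {m p : ℕ} (h : (Fin m → ℝ) → (Fin p → ℝ))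
    (hh : ∀ i, AnalyticAt ℝ (fun x => h x i) 0) : Ideal (AnalyticGerm m) :=
  Ideal.span (Set.range fun i => AnalyticGerm.mk (fun x => h x i) (hh i))

/-- The local algebra `Q₀(h) = 𝒪ₘ / I_h`. -/
abbrev LocalAlgebra {m p : ℕ} (h : (Fin m → ℝ) → (Fin p → ℝ))
    (hh : ∀ i, AnalyticAt ℝ (fun x => h x i) 0) : Type :=
  AnalyticGerm m ⧸ componentIdeal h hh

/-- The germ at the origin of an analytic family of Hermitian `n × n` matrices with three
real parameters. -/
structure IsHamiltonianGerm {n : ℕ} (H : (Fin 3 → ℝ) → Matrix (Fin n) (Fin n) ℂ) : Prop where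
  analyticAt : ∀ i j, AnalyticAt ℝ (fun x => H x i j) 0
  isHermitian : ∀ᶠ x in 𝓝 0, (H x).IsHermitian

/-- `H'(x, y, z, λ) = H(x, y, z) - (λ₀ + λ) 𝟙`, where `v = (x, y, z, λ)`. -/
def shiftedFamily {n : ℕ} (H : (Fin 3 → ℝ) → Matrix (Fin n) (Fin n) ℂ) (lam₀ : ℝ)
    (v : Fin 4 → ℝ) : Matrix (Fin n) (Fin n) ℂ :=
  H (Fin.init v) - ((lam₀ + v (Fin.last 3) : ℝ) : ℂ) • 1

/-- The `(n-1) × (n-1)` minor of `A` on the rows `r` and the columns `c`. -/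
def minor {n : ℕ} (A : Matrix (Fin n) (Fin n) ℂ) (r c : Fin (n - 1) ↪o Fin n) : ℂ :=
  (A.submatrix r c).det

theorem analyticAt_minor {n : ℕ} {H : (Fin 3 → ℝ) → Matrix (Fin n) (Fin n) ℂ}
    (hH : IsHamiltonianGerm H) (lam₀ : ℝ) (r c : Fin (n - 1) ↪o Fin n) :
    AnalyticAt ℝ (fun v => minor (shiftedFamily H lam₀ v) r c) 0 := by
  have hproj : AnalyticAt ℝ (fun v : Fin 4 → ℝ => (Fin.init v : Fin 3 → ℝ)) 0 := by
    rw [analyticAt_pi_iff]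
    intro i
    exact (ContinuousLinearMap.proj (R := ℝ) (φ := fun _ : Fin 4 => ℝ) i.castSucc).analyticAt 0
  have hlam : AnalyticAt ℝ (fun v : Fin 4 → ℝ => ((lam₀ + v (Fin.last 3) : ℝ) : ℂ)) 0 := by
    have h1 : AnalyticAt ℝ (fun v : Fin 4 → ℝ => lam₀ + v (Fin.last 3)) 0 :=
      analyticAt_const.add
        ((ContinuousLinearMap.proj (R := ℝ) (φ := fun _ : Fin 4 => ℝ) (Fin.last 3)).analyticAt 0)
    exact (Complex.ofRealCLM.analyticAt _).comp h1
  have hentry : ∀ i j, AnalyticAt ℝ (fun v => shiftedFamily H lam₀ v i j) 0 := by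
    intro i j
    have h0 : (Fin.init (0 : Fin 4 → ℝ) : Fin 3 → ℝ) = 0 := rfl
    have h1 : AnalyticAt ℝ (fun v : Fin 4 → ℝ => H (Fin.init v) i j) 0 :=
      AnalyticAt.fun_comp (g := fun x => H x i j) (by rw [h0]; exact hH.analyticAt i j) hproj
    simp only [shiftedFamily, Matrix.sub_apply, Matrix.smul_apply, smul_eq_mul]
    exact h1.sub (hlam.mul analyticAt_const)
  simp only [minor, Matrix.det_apply', Matrix.submatrix_apply]
  refine Finset.analyticAt_fun_sum _ fun σ _ => ?_
  exact analyticAt_const.mul (Finset.analyticAt_fun_prod _ fun i _ => hentry _ _)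

/-- The ideal `J ⊆ 𝒪₄` generated by the `(n-1) × (n-1)` minors of `H - (λ₀ + λ) 𝟙`. The minors
are complex valued and those on `(r, c)` and `(c, r)` are complex conjugate; as usual, the real
ideal that they generate is the one generated by their real and imaginary parts. -/
def minorIdeal {n : ℕ} (H : (Fin 3 → ℝ) → Matrix (Fin n) (Fin n) ℂ)
    (hH : IsHamiltonianGerm H) (lam₀ : ℝ) : Ideal (AnalyticGerm 4) :=
  Ideal.span
    ((Set.range fun rc : (Fin (n - 1) ↪o Fin n) × (Fin (n - 1) ↪o Fin n) =>
        AnalyticGerm.mk (fun v => (minor (shiftedFamily H lam₀ v) rc.1 rc.2).re)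
          ((Complex.reCLM.analyticAt _).comp (analyticAt_minor hH lam₀ rc.1 rc.2))) ∪
      (Set.range fun rc : (Fin (n - 1) ↪o Fin n) × (Fin (n - 1) ↪o Fin n) =>
        AnalyticGerm.mk (fun v => (minor (shiftedFamily H lam₀ v) rc.1 rc.2).im)
          ((Complex.imCLM.analyticAt _).comp (analyticAt_minor hH lam₀ rc.1 rc.2))))

/-- `λ₀` is a two-fold degenerate eigenvalue of the (Hermitian) matrix `A₀`. -/
def IsTwofoldEigenvalue {n : ℕ} (A₀ : Matrix (Fin n) (Fin n) ℂ) (lam₀ : ℝ) : Prop :=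
  Module.finrank ℂ (Module.End.eigenspace (Matrix.toLin' A₀) (lam₀ : ℂ)) = 2

/-- `G₀` is unitary, and `G₀⁻¹ A₀ G₀ = [[λ₀ 𝟙₂, 0], [0, B₀]]` with `B₀ - λ₀ 𝟙` invertible.
The columns of `G₀` are indexed by the two blocks, of sizes `2` and `n - 2`. -/
structure IsPartialDiagonalization {n : ℕ} (A₀ : Matrix (Fin n) (Fin n) ℂ) (lam₀ : ℝ)
    (G₀ : Matrix (Fin n) (Fin 2 ⊕ Fin (n - 2)) ℂ)
    (B₀ : Matrix (Fin (n - 2)) (Fin (n - 2)) ℂ) : Prop where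
  conjTranspose_mul_self : G₀ᴴ * G₀ = 1
  mul_conjTranspose_self : G₀ * G₀ᴴ = 1
  normalForm : G₀ᴴ * A₀ * G₀ = fromBlocks ((lam₀ : ℂ) • 1) 0 0 B₀
  isUnit : IsUnit (B₀ - (lam₀ : ℂ) • 1)

/-- The Schrieffer–Wolff map
`g(S, C, A_eff) = G₀ e^S (A₀' + C + A_eff) e^{-S} G₀⁻¹`, where `A₀' = [[λ₀ 𝟙₂, 0], [0, B₀]]`,
`S = [[0, S₁₂], [S₂₁, 0]]`, `C = [[0, 0], [0, C₂₂]]`, `A_eff = [[E, 0], [0, 0]]` and `G₀` is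
unitary. -/
def swMap {n : ℕ} (lam₀ : ℝ) (G₀ : Matrix (Fin n) (Fin 2 ⊕ Fin (n - 2)) ℂ)
    (B₀ : Matrix (Fin (n - 2)) (Fin (n - 2)) ℂ)
    (S₁₂ : Matrix (Fin 2) (Fin (n - 2)) ℂ) (S₂₁ : Matrix (Fin (n - 2)) (Fin 2) ℂ)
    (C₂₂ : Matrix (Fin (n - 2)) (Fin (n - 2)) ℂ) (E : Matrix (Fin 2) (Fin 2) ℂ) :
    Matrix (Fin n) (Fin n) ℂ :=
  G₀ * NormedSpace.exp (fromBlocks 0 S₁₂ S₂₁ 0) *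
    (fromBlocks ((lam₀ : ℂ) • 1) 0 0 B₀ + fromBlocks 0 0 0 C₂₂ + fromBlocks E 0 0 0) *
    NormedSpace.exp (-fromBlocks 0 S₁₂ S₂₁ 0) * G₀ᴴ

/-- A Hermitian Schrieffer–Wolff decomposition of the germ `H` at `λ₀`:
`H(x) = g(S(x), C(x), A_eff(x))` near the origin, with `S`, `C`, `A_eff` analytic at the origin
and zero there, `S` anti-Hermitian, and `C`, `A_eff` Hermitian. -/
structure IsSWDecomposition {n : ℕ} (H : (Fin 3 → ℝ) → Matrix (Fin n) (Fin n) ℂ) (lam₀ : ℝ)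
    (G₀ : Matrix (Fin n) (Fin 2 ⊕ Fin (n - 2)) ℂ)
    (B₀ : Matrix (Fin (n - 2)) (Fin (n - 2)) ℂ)
    (S₁₂ : (Fin 3 → ℝ) → Matrix (Fin 2) (Fin (n - 2)) ℂ)
    (S₂₁ : (Fin 3 → ℝ) → Matrix (Fin (n - 2)) (Fin 2) ℂ)
    (C₂₂ : (Fin 3 → ℝ) → Matrix (Fin (n - 2)) (Fin (n - 2)) ℂ)
    (E : (Fin 3 → ℝ) → Matrix (Fin 2) (Fin 2) ℂ) : Prop where
  diag : IsPartialDiagonalization (H 0) lam₀ G₀ B₀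
  analyticAt_S₁₂ : ∀ i j, AnalyticAt ℝ (fun x => S₁₂ x i j) 0
  analyticAt_S₂₁ : ∀ i j, AnalyticAt ℝ (fun x => S₂₁ x i j) 0
  analyticAt_C₂₂ : ∀ i j, AnalyticAt ℝ (fun x => C₂₂ x i j) 0
  analyticAt_E : ∀ i j, AnalyticAt ℝ (fun x => E x i j) 0
  S₁₂_zero : S₁₂ 0 = 0
  S₂₁_zero : S₂₁ 0 = 0
  C₂₂_zero : C₂₂ 0 = 0
  E_zero : E 0 = 0
  antiHermitian : ∀ᶠ x in 𝓝 0, S₁₂ x = -(S₂₁ x)ᴴ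
  isHermitian_C₂₂ : ∀ᶠ x in 𝓝 0, (C₂₂ x).IsHermitian
  isHermitian_E : ∀ᶠ x in 𝓝 0, (E x).IsHermitian
  decomposition : ∀ᶠ x in 𝓝 0, H x = swMap lam₀ G₀ B₀ (S₁₂ x) (S₂₁ x) (C₂₂ x) (E x)

/-- `Herm₀(2)`: the real vector space of traceless Hermitian `2 × 2` matrices. -/
def tracelessHermitian : Submodule ℝ (Matrix (Fin 2) (Fin 2) ℂ) where
  carrier := {A | A.IsHermitian ∧ A.trace = 0}
  zero_mem' := ⟨isHermitian_zero, trace_zero _ _⟩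
  add_mem' hA hB := ⟨hA.1.add hB.1, by rw [trace_add, hA.2, hB.2, add_zero]⟩
  smul_mem' c A hA :=
    ⟨by rw [IsHermitian, conjTranspose_smul, hA.1.eq, star_trivial],
      by rw [trace_smul, hA.2, smul_zero]⟩

/-- The traceless part of a `2 × 2` matrix. -/
def tracelessPart (E : Matrix (Fin 2) (Fin 2) ℂ) : Matrix (Fin 2) (Fin 2) ℂ :=
  E - (E.trace / 2) • 1

/-- `h : (ℝ³, 0) → (ℝ³, 0)` is an effective map germ of `H` at `λ₀`: the components of `h` are
the coordinates, in some basis of `Herm₀(2)`, of the traceless part of the `2 × 2` effective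
Hamiltonian of a Schrieffer–Wolff decomposition of `H`. -/
structure IsEffectiveGerm {n : ℕ} (H : (Fin 3 → ℝ) → Matrix (Fin n) (Fin n) ℂ) (lam₀ : ℝ)
    (h : (Fin 3 → ℝ) → (Fin 3 → ℝ)) : Prop where
  analyticAt : ∀ i, AnalyticAt ℝ (fun x => h x i) 0
  exists_decomposition : ∃ G₀ B₀ S₁₂ S₂₁ C₂₂ E,
    IsSWDecomposition H lam₀ G₀ B₀ S₁₂ S₂₁ C₂₂ E ∧
    ∃ b : Module.Basis (Fin 3) ℝ tracelessHermitian,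
      ∀ᶠ x in 𝓝 0, tracelessPart (E x) =
        ∑ i, h x i • (b i : Matrix (Fin 2) (Fin 2) ℂ)

end

/-! A Schrieffer–Wolff decomposition block-diagonalizes the family: near the origin `H - (λ₀ + λ) =
U * diag(P, Q) * W`, where `U` and `W` are analytic and mutually inverse, `P = E - λ`, and `Q = B₀ +
C₂₂ - (λ₀ + λ)` is invertible at the origin. Up to sign the minors of size `n - 1` are the entries
of the adjugate, and adjugates reverse products, so multiplying by `U` and `W` does not change the
ideal they generate. Moreover `adj diag(P, Q) = diag(det Q • adj P, det P • adj Q)`: here `det Q` is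
a unit, `adj P` has the entries of the 2 × 2 matrix `P` up to sign and order, and `det P` lies in
the ideal of those entries. Hence `J` is generated by the real and imaginary parts of the entries of
`E - λ` (`IsSWDecomposition.minorIdeal_le_iff`).

With `t = tr E / 2` one has `E - λ = tracelessPart E - (λ - t) • 1`, so `J = (λ - t, h₁, h₂, h₃)`
for any choice of basis (`IsSWDecomposition.minorIdeal_eq`). Restriction to the graph `λ = t(x)` has
kernel `(λ - t)` by Hadamard's lemma, and it identifies the quotient by `J` with `𝒪₃ / (h₁, h₂, h₃)`
(`AnalyticGerm.quotientGraphEquiv`).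

Existence is the analytic inverse function theorem for `(S, C, A_eff) ↦ e^S (A₀' + C + A_eff)
e^{-S}`, whose derivative at the origin is invertible because `B₀ - λ₀` is. The symmetry conditions
on `S`, `C`, `A_eff` follow from local uniqueness of the solution (`exists_analytic_blockSWMap`). -/

noncomputable section

/-! ### Hadamard's lemma through divided differences of power series. -/

section Hadamard

variable {E F : Type*} [NormedAddCommGroup E] [NormedSpace ℝ E]
  [NormedAddCommGroup F] [NormedSpace ℝ F]

/-- The formal power series of the divided difference `(f y - f (L y)) / ℓ y`, where
`y = L y + ℓ y • e` and `f` has the power series `p`. -/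
def FormalMultilinearSeries.dividedDifference (p : FormalMultilinearSeries ℝ E F)
    (L : E →L[ℝ] E) (e : E) : FormalMultilinearSeries ℝ E F := fun k =>
  ∑ j : Fin (k + 1), ((p (k + 1)).curryMid j e).compContinuousLinearMap
    (fun i : Fin k => if j.succAbove i < j then L else ContinuousLinearMap.id ℝ E)

/-- Telescoping: the slots are changed from `y` to `z` one at a time, from left to right, and each
change contributes `c • e` in a single slot. -/
theorem ContinuousMultilinearMap.apply_sub_apply_eq_sum {k : ℕ}
    (A : ContinuousMultilinearMap ℝ (fun _ : Fin (k + 1) => E) F) (y z e : E) (c : ℝ)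
    (hy : y = z + c • e) :
    A (fun _ => y) - A (fun _ => z) =
      c • ∑ j : Fin (k + 1), A (fun i => if i < j then z else if i = j then e else y) := by
  let a : ℕ → F := fun j => A (fun i => if (i : ℕ) < j then z else y)
  have h0 : A (fun _ => y) = a 0 := by simp [a]
  have h1 : A (fun _ => z) = a (k + 1) := by
    simp only [a]
    congr 1
    funext i
    rw [if_pos i.2]
  rw [h0, h1, ← Finset.sum_range_sub', Finset.sum_range, Finset.smul_sum]
  refine Finset.sum_congr rfl fun j _ => ?_
  let m : Fin (k + 1) → E := fun i => if i < j then z else y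
  have e1 : (fun i : Fin (k + 1) => if (i : ℕ) < (j : ℕ) then z else y)
      = Function.update m j y := by
    funext i
    by_cases hij : i = j
    · subst hij; simp
    · simp [m, hij]
  have e2 : (fun i : Fin (k + 1) => if (i : ℕ) < (j : ℕ) + 1 then z else y)
      = Function.update m j z := by
    funext i
    by_cases hij : i = j
    · subst hij; simp
    · have : (i : ℕ) < (j : ℕ) + 1 ↔ i < j := by
        rw [Fin.lt_def]
        have : (i : ℕ) ≠ j := fun h => hij (Fin.ext h)
        omega
      simp [m, hij, this]
  have e3 : (fun i : Fin (k + 1) => if i < j then z else if i = j then e else y)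
      = Function.update m j e := by
    funext i
    by_cases hij : i = j
    · subst hij; simp
    · simp [m, hij]
  simp only [a]
  rw [e1, e2, e3, ← A.map_update_sub, ← A.map_update_smul]
  congr 2
  rw [hy]
  abel

theorem FormalMultilinearSeries.dividedDifference_apply (p : FormalMultilinearSeries ℝ E F)
    (L : E →L[ℝ] E) (e y : E) (c : ℝ) (hy : y = L y + c • e) (k : ℕ) :
    p (k + 1) (fun _ => y) - p (k + 1) (fun _ => L y) =
      c • p.dividedDifference L e k (fun _ => y) := by
  rw [ContinuousMultilinearMap.apply_sub_apply_eq_sum _ y (L y) e c hy]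
  simp only [dividedDifference, _root_.sum_apply,
    ContinuousMultilinearMap.compContinuousLinearMap_apply,
    ContinuousMultilinearMap.curryMid_apply]
  congr 1
  refine Finset.sum_congr rfl fun j _ => ?_
  congr 1
  funext i
  refine Fin.succAboveCases j ?_ (fun i => ?_) i
  · simp
  · rw [Fin.insertNth_apply_succAbove, if_neg (Fin.succAbove_ne j i)]
    split_ifs <;> rfl

theorem FormalMultilinearSeries.norm_dividedDifference_le (p : FormalMultilinearSeries ℝ E F)
    {L : E →L[ℝ] E} (hL : ‖L‖ ≤ 1) (e : E) (k : ℕ) :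
    ‖p.dividedDifference L e k‖ ≤ (k + 1) * (‖p (k + 1)‖ * ‖e‖) := by
  have hterm : ∀ j : Fin (k + 1), ‖((p (k + 1)).curryMid j e).compContinuousLinearMap
      (fun i : Fin k => if j.succAbove i < j then L else ContinuousLinearMap.id ℝ E)‖ ≤
        ‖p (k + 1)‖ * ‖e‖ := by
    intro j
    refine (ContinuousMultilinearMap.norm_compContinuousLinearMap_le _ _).trans ?_
    refine (mul_le_of_le_one_right (norm_nonneg _) ?_).trans ?_
    · refine Finset.prod_le_one (fun _ _ => norm_nonneg _) fun i _ => ?_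
      split_ifs
      · exact hL
      · exact ContinuousLinearMap.norm_id_le
    · refine (ContinuousLinearMap.le_opNorm _ _).trans ?_
      rw [ContinuousMultilinearMap.norm_curryMid]
  refine (norm_sum_le _ _).trans ((Finset.sum_le_sum fun j _ => hterm j).trans ?_)
  simp

theorem FormalMultilinearSeries.radius_dividedDifference_pos
    (p : FormalMultilinearSeries ℝ E F) (hp : 0 < p.radius)
    {L : E →L[ℝ] E} (hL : ‖L‖ ≤ 1) (e : E) : 0 < (p.dividedDifference L e).radius := by
  obtain ⟨C, r, hC, hr, hb⟩ := p.le_mul_pow_of_radius_pos hp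
  have hr' : 0 < (2 * r)⁻¹ := by positivity
  -- The coefficients of `p` grow at most like `C * r ^ k`; halving the radius `1 / r` absorbs the
  -- extra factor `k + 1 ≤ 2 ^ k`.
  let s : NNReal := ⟨(2 * r)⁻¹, hr'.le⟩
  have hs : 0 < s := hr'
  refine lt_of_lt_of_le (ENNReal.coe_pos.mpr hs)
    (FormalMultilinearSeries.le_radius_of_bound _ (C * r * ‖e‖) fun k => ?_)
  have h1 := p.norm_dividedDifference_le hL e k
  have h2 := hb (k + 1)
  have h3 : ((k : ℝ) + 1) ≤ 2 ^ k := by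
    exact_mod_cast Nat.lt_two_pow_self
  calc ‖p.dividedDifference L e k‖ * ((2 * r)⁻¹) ^ k
      ≤ (2 ^ k * ((C * r ^ (k + 1)) * ‖e‖)) * ((2 * r)⁻¹) ^ k := by
          gcongr
          exact h1.trans (by gcongr)
      _ = C * r * ‖e‖ := by
          rw [inv_pow, mul_pow]
          field_simp
          ring

/-- Hadamard's lemma for analytic functions: `f y - f (L y)` is divisible by the linear form `ℓ`
when `L` is the projection onto the kernel of `ℓ` along `e`. -/
theorem AnalyticAt.exists_sub_eq_smul [CompleteSpace F] {f : E → F} (hf : AnalyticAt ℝ f 0)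
    {L : E →L[ℝ] E} (hL : ‖L‖ ≤ 1) (e : E) (l : E → ℝ) (hl : ∀ y, y = L y + l y • e) :
    ∃ q : E → F, AnalyticAt ℝ q 0 ∧ ∀ᶠ y in 𝓝 0, f y - f (L y) = l y • q y := by
  obtain ⟨p, hp⟩ := hf
  have hrad : 0 < p.radius := hp.radius_pos
  have hQ := (p.dividedDifference L e).hasFPowerSeriesOnBall
    (p.radius_dividedDifference_pos hrad hL e)
  refine ⟨(p.dividedDifference L e).sum, hQ.analyticAt, ?_⟩
  have h1 := hp.eventually_hasSum
  have h2 := (L.continuous.tendsto' 0 0 (map_zero L)).eventually hp.eventually_hasSum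
  have h3 := hQ.hasFPowerSeriesAt.eventually_hasSum
  filter_upwards [h1, h2, h3] with y hy1 hy2 hy3
  simp only [zero_add] at hy1 hy2 hy3
  have hd := hy1.sub hy2
  have hd' := (hasSum_nat_add_iff' 1).mpr hd
  have hz : p 0 (fun _ => y) - p 0 (fun _ => L y) = 0 := by
    rw [sub_eq_zero]
    congr 1
    funext i
    exact i.elim0
  simp only [Finset.range_one, Finset.sum_singleton, hz, sub_zero] at hd'
  refine hd'.unique ?_
  simp only [p.dividedDifference_apply L e y (l y) (hl y)]
  exact hy3.const_smul (l y)

end Hadamard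

/-! ### Germs and their pullbacks. -/

namespace AnalyticGerm

variable {m k : ℕ}

theorem mk_eq_mk {f g : (Fin m → ℝ) → ℝ} {hf : AnalyticAt ℝ f 0} {hg : AnalyticAt ℝ g 0} :
    mk f hf = mk g hg ↔ f =ᶠ[𝓝 0] g := by
  refine (Ideal.Quotient.eq (I := germwiseZero m)).trans ?_
  exact ⟨fun h => Filter.eventuallyEq_iff_sub.mpr h, fun h => Filter.eventuallyEq_iff_sub.mp h⟩

theorem exists_mk (a : AnalyticGerm m) : ∃ f hf, mk f hf = a := by
  obtain ⟨⟨f, hf⟩, h⟩ := Ideal.Quotient.mk_surjective (I := germwiseZero m) a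
  exact ⟨f, hf, h⟩

theorem mk_mul {f g : (Fin m → ℝ) → ℝ} (hf : AnalyticAt ℝ f 0) (hg : AnalyticAt ℝ g 0) :
    mk f hf * mk g hg = mk (fun x => f x * g x) (hf.mul hg) := rfl

theorem mk_sub {f g : (Fin m → ℝ) → ℝ} (hf : AnalyticAt ℝ f 0) (hg : AnalyticAt ℝ g 0) :
    mk f hf - mk g hg = mk (fun x => f x - g x) (hf.sub hg) := rfl

/-- Composition with an analytic map germ, on representatives. -/
def compAlgHom (g : (Fin m → ℝ) → (Fin k → ℝ)) (hg : AnalyticAt ℝ g 0) (h0 : g 0 = 0) :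
    analyticFunctions k →ₐ[ℝ] analyticFunctions m where
  toFun f := ⟨fun x => f.1 (g x), AnalyticAt.fun_comp (by rw [h0]; exact f.2) hg⟩
  map_one' := rfl
  map_mul' _ _ := rfl
  map_zero' := rfl
  map_add' _ _ := rfl
  commutes' _ := rfl

/-- Composition with an analytic map germ, as a homomorphism of algebras of germs. -/
def pullback (g : (Fin m → ℝ) → (Fin k → ℝ)) (hg : AnalyticAt ℝ g 0) (h0 : g 0 = 0) :
    AnalyticGerm k →ₐ[ℝ] AnalyticGerm m :=
  Ideal.quotientMapₐ (R₁ := ℝ) (I := germwiseZero k) (germwiseZero m) (compAlgHom g hg h0)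
    (fun f hf => by
      have ht : Tendsto g (𝓝 0) (𝓝 0) := by
        have := hg.continuousAt.tendsto
        rwa [h0] at this
      exact ht.eventually hf)

theorem pullback_mk (g : (Fin m → ℝ) → (Fin k → ℝ)) (hg : AnalyticAt ℝ g 0) (h0 : g 0 = 0)
    (f : (Fin k → ℝ) → ℝ) (hf : AnalyticAt ℝ f 0) :
    pullback g hg h0 (mk f hf) =
      mk (fun x => f (g x)) (AnalyticAt.fun_comp (by rw [h0]; exact hf) hg) := rfl

end AnalyticGerm

open AnalyticGerm

/-! ### Complex-valued germs whose real and imaginary parts lie in a real ideal. -/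

/-- The real and the imaginary part of the complex valued function `f` are analytic at the origin,
and their germs lie in the ideal `I`. -/
def ComplexMem {m : ℕ} (I : Ideal (AnalyticGerm m)) (f : (Fin m → ℝ) → ℂ) : Prop :=
  (∃ hf : AnalyticAt ℝ (fun x => (f x).re) 0, mk _ hf ∈ I) ∧
    ∃ hf : AnalyticAt ℝ (fun x => (f x).im) 0, mk _ hf ∈ I

section ComplexMem

variable {m : ℕ} {I : Ideal (AnalyticGerm m)} {f g : (Fin m → ℝ) → ℂ}

theorem AnalyticAt.complex_re {E : Type*} [NormedAddCommGroup E] [NormedSpace ℝ E] {f : E → ℂ}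
    {x : E} (hf : AnalyticAt ℝ f x) : AnalyticAt ℝ (fun x => (f x).re) x :=
  (Complex.reCLM.analyticAt _).comp hf

theorem AnalyticAt.complex_im {E : Type*} [NormedAddCommGroup E] [NormedSpace ℝ E] {f : E → ℂ}
    {x : E} (hf : AnalyticAt ℝ f x) : AnalyticAt ℝ (fun x => (f x).im) x :=
  (Complex.imCLM.analyticAt _).comp hf

theorem AnalyticAt.complex_ofReal {E : Type*} [NormedAddCommGroup E] [NormedSpace ℝ E]
    {f : E → ℝ} {x : E} (hf : AnalyticAt ℝ f x) : AnalyticAt ℝ (fun x => (f x : ℂ)) x :=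
  (Complex.ofRealCLM.analyticAt _).comp hf

theorem AnalyticGerm.mk_mem_congr {f g : (Fin m → ℝ) → ℝ} {hg : AnalyticAt ℝ g 0}
    (h : mk g hg ∈ I) (hfg : f =ᶠ[𝓝 0] g) : ∃ hf : AnalyticAt ℝ f 0, mk f hf ∈ I := by
  refine ⟨hg.congr hfg.symm, ?_⟩
  rwa [mk_eq_mk.mpr hfg]

theorem ComplexMem.congr (hg : ComplexMem I g) (h : f =ᶠ[𝓝 0] g) : ComplexMem I f := by
  obtain ⟨⟨h1, h2⟩, h3, h4⟩ := hg
  exact ⟨mk_mem_congr h2 (h.fun_comp Complex.re), mk_mem_congr h4 (h.fun_comp Complex.im)⟩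

theorem ComplexMem.zero : ComplexMem I (fun _ => 0) :=
  ⟨⟨analyticAt_const, I.zero_mem⟩, ⟨analyticAt_const, I.zero_mem⟩⟩

theorem ComplexMem.add (hf : ComplexMem I f) (hg : ComplexMem I g) :
    ComplexMem I (fun x => f x + g x) := by
  obtain ⟨⟨h1, h2⟩, h3, h4⟩ := hf
  obtain ⟨⟨k1, k2⟩, k3, k4⟩ := hg
  exact ⟨⟨h1.add k1, I.add_mem h2 k2⟩, ⟨h3.add k3, I.add_mem h4 k4⟩⟩

theorem ComplexMem.const_mul_left {c : (Fin m → ℝ) → ℂ} (hc : AnalyticAt ℝ c 0)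
    (hf : ComplexMem I f) : ComplexMem I (fun x => c x * f x) := by
  obtain ⟨⟨h1, h2⟩, h3, h4⟩ := hf
  have r := hc.complex_re
  have i := hc.complex_im
  refine ⟨⟨(r.mul h1).sub (i.mul h3), ?_⟩, ⟨(r.mul h3).add (i.mul h1), ?_⟩⟩
  · exact I.sub_mem (I.mul_mem_left (mk _ r) h2) (I.mul_mem_left (mk _ i) h4)
  · exact I.add_mem (I.mul_mem_left (mk _ r) h4) (I.mul_mem_left (mk _ i) h2)

theorem ComplexMem.mul_right {c : (Fin m → ℝ) → ℂ} (hf : ComplexMem I f)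
    (hc : AnalyticAt ℝ c 0) : ComplexMem I (fun x => f x * c x) :=
  (hf.const_mul_left hc).congr (.of_eq (funext fun _ => mul_comm _ _))

theorem ComplexMem.neg (hf : ComplexMem I f) : ComplexMem I (fun x => - f x) :=
  (hf.const_mul_left (c := fun _ => -1) analyticAt_const).congr
    (.of_eq (funext fun _ => (neg_one_mul _).symm))

theorem ComplexMem.sub (hf : ComplexMem I f) (hg : ComplexMem I g) :
    ComplexMem I (fun x => f x - g x) :=
  (hf.add hg.neg).congr (.of_eq (funext fun _ => sub_eq_add_neg _ _))

theorem ComplexMem.sum {ι : Type*} (s : Finset ι) {F : ι → (Fin m → ℝ) → ℂ}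
    (h : ∀ i ∈ s, ComplexMem I (F i)) : ComplexMem I (fun x => ∑ i ∈ s, F i x) := by
  classical
  induction s using Finset.induction_on with
  | empty => simpa using ComplexMem.zero
  | insert a s ha ih =>
    simp only [Finset.sum_insert ha]
    exact (h a (Finset.mem_insert_self a s)).add
      (ih fun i hi => h i (Finset.mem_insert_of_mem hi))

theorem ComplexMem.ofReal {f : (Fin m → ℝ) → ℝ} {hf : AnalyticAt ℝ f 0} (h : mk f hf ∈ I) :
    ComplexMem I (fun x => (f x : ℂ)) :=
  ⟨⟨hf, h⟩, ⟨analyticAt_const, I.zero_mem⟩⟩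

end ComplexMem

/-! ### Eliminating the variable `λ` along a graph. -/

section Graph

theorem analyticAt_fin_init {m : ℕ} (v : Fin (m + 1) → ℝ) :
    AnalyticAt ℝ (fun v : Fin (m + 1) → ℝ => (Fin.init v : Fin m → ℝ)) v := by
  rw [analyticAt_pi_iff]
  intro i
  exact (ContinuousLinearMap.proj (R := ℝ) (φ := fun _ : Fin (m + 1) => ℝ) i.castSucc).analyticAt v

theorem fin_init_zero {m : ℕ} : (Fin.init (0 : Fin (m + 1) → ℝ) : Fin m → ℝ) = 0 := rfl

theorem analyticAt_eval {m : ℕ} (i : Fin m) (v : Fin m → ℝ) :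
    AnalyticAt ℝ (fun v : Fin m → ℝ => v i) v :=
  (ContinuousLinearMap.proj (R := ℝ) (φ := fun _ : Fin m => ℝ) i).analyticAt v

theorem AnalyticAt.fin_snoc {E : Type*} [NormedAddCommGroup E] [NormedSpace ℝ E] {m : ℕ}
    {f : E → Fin m → ℝ} {g : E → ℝ} {x : E} (hf : AnalyticAt ℝ f x) (hg : AnalyticAt ℝ g x) :
    AnalyticAt ℝ (fun y => (Fin.snoc (f y) (g y) : Fin (m + 1) → ℝ)) x := by
  rw [analyticAt_pi_iff]
  intro i
  refine Fin.lastCases ?_ (fun j => ?_) i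
  · simpa using hg
  · simpa using (analyticAt_pi_iff.mp hf) j

/-- The projection of `ℝᵐ⁺¹` onto the hyperplane on which the last coordinate vanishes. -/
def killLast (m : ℕ) : (Fin (m + 1) → ℝ) →L[ℝ] (Fin (m + 1) → ℝ) :=
  ContinuousLinearMap.pi fun i =>
    if i = Fin.last m then 0 else ContinuousLinearMap.proj (R := ℝ) (φ := fun _ => ℝ) i

theorem killLast_apply (m : ℕ) (v : Fin (m + 1) → ℝ) :
    killLast m v = Fin.snoc (Fin.init v) 0 := by
  funext i
  refine Fin.lastCases ?_ (fun j => ?_) i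
  · simp [killLast]
  · simp [killLast, Fin.init, (Fin.castSucc_lt_last j).ne]

theorem norm_killLast_le (m : ℕ) : ‖killLast m‖ ≤ 1 := by
  refine ContinuousLinearMap.opNorm_le_bound _ zero_le_one fun v => ?_
  rw [one_mul, pi_norm_le_iff_of_nonneg (norm_nonneg v)]
  intro i
  by_cases h : i = Fin.last m
  · simp [killLast, h]
  · simpa [killLast, h] using norm_le_pi_norm v i

variable {m : ℕ} {t : (Fin m → ℝ) → ℝ}

theorem analyticAt_graph (ht : AnalyticAt ℝ t 0) :
    AnalyticAt ℝ (fun x => (Fin.snoc x (t x) : Fin (m + 1) → ℝ)) 0 :=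
  analyticAt_id.fin_snoc ht

theorem fin_snoc_zero_zero : (Fin.snoc (0 : Fin m → ℝ) (0 : ℝ) : Fin (m + 1) → ℝ) = 0 := by
  funext i
  refine Fin.lastCases ?_ (fun j => ?_) i <;> simp

theorem graph_zero (h0 : t 0 = 0) : (Fin.snoc (0 : Fin m → ℝ) (t 0) : Fin (m + 1) → ℝ) = 0 := by
  rw [h0, fin_snoc_zero_zero]

theorem analyticAt_last_sub (ht : AnalyticAt ℝ t 0) :
    AnalyticAt ℝ (fun v : Fin (m + 1) → ℝ => v (Fin.last m) - t (Fin.init v)) 0 :=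
  (analyticAt_eval _ _).sub (AnalyticAt.fun_comp (g := t) (by rw [fin_init_zero]; exact ht)
    (analyticAt_fin_init 0))

/-- A germ of `m + 1` variables agrees with its restriction to the graph of `t` modulo
`λ - t(x)`. -/
theorem AnalyticGerm.sub_pullback_graph_mem (ht : AnalyticAt ℝ t 0) (h0 : t 0 = 0)
    (a : AnalyticGerm (m + 1)) :
    a - pullback Fin.init (analyticAt_fin_init 0) fin_init_zero
        (pullback _ (analyticAt_graph ht) (graph_zero h0) a) ∈
      Ideal.span {mk _ (analyticAt_last_sub ht)} := by
  obtain ⟨f, hf, rfl⟩ := exists_mk a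
  have htinit : AnalyticAt ℝ (fun v : Fin (m + 1) → ℝ => t (Fin.init v)) 0 :=
    AnalyticAt.fun_comp (g := t) (by rw [fin_init_zero]; exact ht) (analyticAt_fin_init 0)
  have hA : AnalyticAt ℝ (fun v : Fin (m + 1) → ℝ =>
      (Fin.snoc (Fin.init v) (t (Fin.init v) + v (Fin.last m)) : Fin (m + 1) → ℝ)) 0 :=
    (analyticAt_fin_init 0).fin_snoc (htinit.add (analyticAt_eval _ _))
  have hA0 : (Fin.snoc (Fin.init (0 : Fin (m + 1) → ℝ))
      (t (Fin.init (0 : Fin (m + 1) → ℝ)) + (0 : Fin (m + 1) → ℝ) (Fin.last m)) :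
        Fin (m + 1) → ℝ) = 0 := by
    rw [fin_init_zero, h0, Pi.zero_apply, add_zero, fin_snoc_zero_zero]
  have hB : AnalyticAt ℝ (fun v : Fin (m + 1) → ℝ =>
      (Fin.snoc (Fin.init v) (v (Fin.last m) - t (Fin.init v)) : Fin (m + 1) → ℝ)) 0 :=
    (analyticAt_fin_init 0).fin_snoc (analyticAt_last_sub ht)
  have hB0 : (Fin.snoc (Fin.init (0 : Fin (m + 1) → ℝ))
      ((0 : Fin (m + 1) → ℝ) (Fin.last m) - t (Fin.init (0 : Fin (m + 1) → ℝ))) :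
        Fin (m + 1) → ℝ) = 0 := by
    rw [fin_init_zero, h0, Pi.zero_apply, sub_zero, fin_snoc_zero_zero]
  have hfA : AnalyticAt ℝ (fun v : Fin (m + 1) → ℝ =>
      f (Fin.snoc (Fin.init v) (t (Fin.init v) + v (Fin.last m)))) 0 :=
    AnalyticAt.fun_comp (by rw [hA0]; exact hf) hA
  -- Hadamard's lemma divides by a coordinate, so the graph is first straightened by the shear `λ ↦
  -- t(x) + λ`. Substituting the inverse shear afterwards turns the divisor `λ` into `λ - t(x)`.
  obtain ⟨q, hq, hfq⟩ := hfA.exists_sub_eq_smul (norm_killLast_le m) (Pi.single (Fin.last m) 1)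
    (fun v => v (Fin.last m)) (fun v => by
      rw [killLast_apply]
      funext i
      refine Fin.lastCases ?_ (fun j => ?_) i
      · simp
      · simp [Fin.init, (Fin.castSucc_lt_last j).ne])
  have hqB : AnalyticAt ℝ (fun v : Fin (m + 1) → ℝ =>
      q (Fin.snoc (Fin.init v) (v (Fin.last m) - t (Fin.init v)))) 0 :=
    AnalyticAt.fun_comp (by rw [hB0]; exact hq) hB
  rw [Ideal.mem_span_singleton]
  refine ⟨mk _ hqB, ?_⟩
  rw [pullback_mk, pullback_mk, mk_sub, mk_mul, mk_eq_mk]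
  have hBt : Tendsto (fun v : Fin (m + 1) → ℝ =>
      (Fin.snoc (Fin.init v) (v (Fin.last m) - t (Fin.init v)) : Fin (m + 1) → ℝ))
        (𝓝 0) (𝓝 0) := by
    have := hB.continuousAt.tendsto
    rwa [hB0] at this
  filter_upwards [hBt.eventually hfq] with v hv
  simpa [killLast_apply] using hv

/-- Eliminating the last variable along the graph of `t`. -/
def AnalyticGerm.quotientGraphEquiv (ht : AnalyticAt ℝ t 0) (h0 : t 0 = 0)
    (I : Ideal (AnalyticGerm m)) :
    (AnalyticGerm (m + 1) ⧸ (Ideal.span {mk _ (analyticAt_last_sub ht)} ⊔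
      I.map (pullback Fin.init (analyticAt_fin_init 0) fin_init_zero))) ≃ₐ[ℝ]
        AnalyticGerm m ⧸ I := by
  let φ := pullback _ (analyticAt_graph ht) (graph_zero h0)
  let ψ := pullback (Fin.init : (Fin (m + 1) → ℝ) → _) (analyticAt_fin_init 0) fin_init_zero
  have hφψ : ∀ a, φ (ψ a) = a := by
    intro a
    obtain ⟨f, hf, rfl⟩ := exists_mk a
    simp only [φ, ψ, pullback_mk, Fin.init_snoc]
  have hsurj : Function.Surjective ((Ideal.Quotient.mkₐ ℝ I).comp φ) := by
    intro b
    obtain ⟨a, rfl⟩ := Ideal.Quotient.mk_surjective b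
    exact ⟨ψ a, by simp [hφψ]⟩
  refine (Ideal.quotientEquivAlgOfEq ℝ ?_).trans (Ideal.quotientKerAlgEquivOfSurjective hsurj)
  apply le_antisymm
  · refine sup_le ?_ ?_
    · rw [Ideal.span_singleton_le_iff_mem, RingHom.mem_ker]
      have : φ (mk _ (analyticAt_last_sub ht)) = 0 := by
        simp only [φ, pullback_mk, Fin.init_snoc, Fin.snoc_last, sub_self]
        rfl
      simp [this]
    · rw [Ideal.map_le_iff_le_comap]
      intro a ha
      rw [Ideal.mem_comap, RingHom.mem_ker]
      have : φ (ψ a) = a := hφψ a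
      simpa [ψ, this, Ideal.Quotient.eq_zero_iff_mem] using ha
  · intro a ha
    rw [RingHom.mem_ker] at ha
    have ha' : φ a ∈ I := by simpa [Ideal.Quotient.eq_zero_iff_mem] using ha
    rw [← sub_add_cancel a (ψ (φ a))]
    exact Ideal.add_mem _ (Ideal.mem_sup_left (sub_pullback_graph_mem ht h0 a))
      (Ideal.mem_sup_right (Ideal.mem_map_of_mem _ ha'))

end Graph

/-! ### The adjugate of a block diagonal matrix. -/

namespace Matrix

section Adjugate

variable {R : Type*} [CommRing R] {a b : Type*} [Fintype a] [DecidableEq a] [Fintype b]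
  [DecidableEq b]

/-- By Cramer's rule an entry is the determinant after one row is replaced by a unit vector; for an
off-diagonal entry this leaves a zero row in a diagonal block. No invertibility is assumed: in the
application `P` vanishes at the origin. -/
theorem adjugate_fromBlocks_zero_zero (P : Matrix a a R) (Q : Matrix b b R) :
    (fromBlocks P 0 0 Q).adjugate =
      fromBlocks (Q.det • P.adjugate) 0 0 (P.det • Q.adjugate) := by
  ext i j
  rw [adjugate_apply]
  rcases i with i | i <;> rcases j with j | j
  · have : (fromBlocks P 0 0 Q).updateRow (Sum.inl j) (Pi.single (Sum.inl i) 1) =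
        fromBlocks (P.updateRow j (Pi.single i 1)) 0 0 Q := by
      ext k l
      rcases k with k | k <;> rcases l with l | l <;>
        simp [updateRow_apply, Pi.single_apply]
    rw [this, det_fromBlocks_zero₁₂]
    simp [adjugate_apply, mul_comm]
  · have : (fromBlocks P 0 0 Q).updateRow (Sum.inr j) (Pi.single (Sum.inl i) 1) =
        fromBlocks P 0 (of fun k l => if k = j then (Pi.single i 1 : a → R) l else 0)
          (Q.updateRow j 0) := by
      ext k l
      rcases k with k | k <;> rcases l with l | l <;>
        simp [updateRow_apply, Pi.single_apply]
    rw [this, det_fromBlocks_zero₁₂, det_eq_zero_of_row_eq_zero (A := Q.updateRow j 0) j (by simp)]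
    simp
  · have : (fromBlocks P 0 0 Q).updateRow (Sum.inl j) (Pi.single (Sum.inr i) 1) =
        fromBlocks (P.updateRow j 0)
          (of fun k l => if k = j then (Pi.single i 1 : b → R) l else 0) 0 Q := by
      ext k l
      rcases k with k | k <;> rcases l with l | l <;>
        simp [updateRow_apply, Pi.single_apply]
    rw [this, det_fromBlocks_zero₂₁, det_eq_zero_of_row_eq_zero (A := P.updateRow j 0) j (by simp)]
    simp
  · have : (fromBlocks P 0 0 Q).updateRow (Sum.inr j) (Pi.single (Sum.inr i) 1) =
        fromBlocks P 0 0 (Q.updateRow j (Pi.single i 1)) := by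
      ext k l
      rcases k with k | k <;> rcases l with l | l <;>
        simp [updateRow_apply, Pi.single_apply]
    rw [this, det_fromBlocks_zero₁₂]
    simp [adjugate_apply]

end Adjugate

end Matrix

/-! ### Analyticity of matrix operations, entry by entry. -/

section AnalyticEntries

variable {E : Type*} [NormedAddCommGroup E] [NormedSpace ℝ E] {x : E}
  {a b c : Type*} [Fintype a] [Fintype b]

theorem AnalyticAt.matrix_det [DecidableEq a] {A : E → Matrix a a ℂ}
    (hA : ∀ i j, AnalyticAt ℝ (A · i j) x) :
    AnalyticAt ℝ (fun y => (A y).det) x := by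
  simp only [Matrix.det_apply']
  refine Finset.analyticAt_fun_sum _ fun σ _ => ?_
  exact analyticAt_const.mul (Finset.analyticAt_fun_prod _ fun i _ => hA _ _)

theorem AnalyticAt.matrix_adjugate [DecidableEq a] {A : E → Matrix a a ℂ}
    (hA : ∀ i j, AnalyticAt ℝ (A · i j) x)
    (i j : a) : AnalyticAt ℝ (fun y => (A y).adjugate i j) x := by
  simp only [Matrix.adjugate_apply]
  refine AnalyticAt.matrix_det fun k l => ?_
  by_cases h : k = j
  · simp only [Matrix.updateRow_apply, if_pos h]
    exact analyticAt_const
  · simpa only [Matrix.updateRow_apply, if_neg h] using hA k l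

theorem AnalyticAt.matrix_mul {d : Type*} {A : E → Matrix c a ℂ} {B : E → Matrix a d ℂ}
    (hA : ∀ i j, AnalyticAt ℝ (A · i j) x) (hB : ∀ i j, AnalyticAt ℝ (B · i j) x) (i : c) (j : d) :
    AnalyticAt ℝ (fun y => (A y * B y) i j) x := by
  simp only [Matrix.mul_apply]
  exact Finset.analyticAt_fun_sum _ fun k _ => (hA i k).mul (hB k j)

attribute [local instance] Matrix.linftyOpNormedAddCommGroup Matrix.linftyOpNormedRing
  Matrix.linftyOpNormedSpace Matrix.linftyOpNormedAlgebra

theorem AnalyticAt.of_matrix_entries [DecidableEq a] [DecidableEq b] {A : E → Matrix a b ℂ}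
    (hA : ∀ i j, AnalyticAt ℝ (A · i j) x) : AnalyticAt ℝ A x := by
  have h : A = fun y => ∑ i, ∑ j, A y i j • Matrix.single i j (1 : ℂ) := by
    funext y
    conv_lhs => rw [Matrix.matrix_eq_sum_single (A y)]
    simp
  rw [h]
  exact Finset.analyticAt_fun_sum _ fun i _ => Finset.analyticAt_fun_sum _ fun j _ =>
    (hA i j).smul analyticAt_const

theorem AnalyticAt.matrix_entry {A : E → Matrix a b ℂ} (hA : AnalyticAt ℝ A x) (i : a) (j : b) :
    AnalyticAt ℝ (A · i j) x :=
  AnalyticAt.comp (g := (Matrix.entryLinearMap ℝ ℂ i j).toContinuousLinearMap)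
    (ContinuousLinearMap.analyticAt _ _) hA

theorem AnalyticAt.matrix_exp [DecidableEq a] {A : E → Matrix a a ℂ}
    (hA : ∀ i j, AnalyticAt ℝ (A · i j) x)
    (i j : a) : AnalyticAt ℝ (fun y => NormedSpace.exp (A y) i j) x :=
  AnalyticAt.matrix_entry
    ((NormedSpace.exp_analytic (𝕂 := ℝ) (A x)).comp (AnalyticAt.of_matrix_entries hA)) i j

end AnalyticEntries

/-- The range misses exactly one point, and an order embedding of `Fin k` is determined by its
range. -/
theorem Fin.exists_eq_succAboveOrderEmb {k : ℕ} (r : Fin k ↪o Fin (k + 1)) :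
    ∃ p, r = Fin.succAboveOrderEmb p := by
  have hcard : (Finset.univ.image r)ᶜ.card = 1 := by
    rw [Finset.card_compl, Finset.card_image_of_injective _ r.injective]
    simp
  obtain ⟨p, hp⟩ := Finset.card_eq_one.mp hcard
  refine ⟨p, DFunLike.coe_injective ((StrictMono.range_inj r.strictMono
    (Fin.succAboveOrderEmb p).strictMono).mp ?_)⟩
  rw [Fin.range_succAboveOrderEmb]
  ext q
  have : q ∈ (Finset.univ.image r)ᶜ ↔ q = p := by rw [hp, Finset.mem_singleton]
  simp only [Finset.mem_compl, Finset.mem_image, Finset.mem_univ, true_and] at this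
  simp only [Set.mem_range, Set.mem_compl_iff, Set.mem_singleton_iff, ← this, not_not]

/-! ### Ideals of minors and adjugates. -/

section MinorIdeal

variable {n : ℕ} {H : (Fin 3 → ℝ) → Matrix (Fin n) (Fin n) ℂ}

/-- Describing the ideal by the ideals `I` that contain it allows complex generators to be exchanged
without complexifying the ring; taking `I` to be the ideal itself recovers membership. -/
theorem minorIdeal_le_iff_minor (hH : IsHamiltonianGerm H) (lam₀ : ℝ)
    (I : Ideal (AnalyticGerm 4)) :
    minorIdeal H hH lam₀ ≤ I ↔
      ∀ r c, ComplexMem I (fun v => minor (shiftedFamily H lam₀ v) r c) := by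
  rw [minorIdeal, Ideal.span_le, Set.union_subset_iff]
  simp only [Set.range_subset_iff, Prod.forall, SetLike.mem_coe]
  constructor
  · intro h r c
    exact ⟨⟨_, h.1 r c⟩, ⟨_, h.2 r c⟩⟩
  · intro h
    exact ⟨fun r c => (h r c).1.2, fun r c => (h r c).2.2⟩

/-- Cofactor formula. For `n = 0` it would fail: the only minor is the empty determinant `1`, while
the adjugate has no entries. -/
theorem minorIdeal_le_iff_adjugate (hn : 0 < n) (hH : IsHamiltonianGerm H) (lam₀ : ℝ)
    (I : Ideal (AnalyticGerm 4)) :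
    minorIdeal H hH lam₀ ≤ I ↔
      ∀ i j, ComplexMem I (fun v => (shiftedFamily H lam₀ v).adjugate i j) := by
  obtain ⟨k, rfl⟩ : ∃ k, n = k + 1 := ⟨n - 1, by omega⟩
  rw [minorIdeal_le_iff_minor]
  have key : ∀ (v : Fin 4 → ℝ) (i j : Fin (k + 1)), (shiftedFamily H lam₀ v).adjugate i j =
      (-1) ^ (j + i : ℕ) * minor (shiftedFamily H lam₀ v)
        (Fin.succAboveOrderEmb j) (Fin.succAboveOrderEmb i) :=
    fun v i j => adjugate_fin_succ_eq_det_submatrix _ i j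
  constructor
  · intro h i j
    simp only [key]
    exact (h _ _).const_mul_left analyticAt_const
  · intro h r c
    obtain ⟨p, rfl⟩ := Fin.exists_eq_succAboveOrderEmb r
    obtain ⟨q, rfl⟩ := Fin.exists_eq_succAboveOrderEmb c
    refine ((h q p).const_mul_left (c := fun _ => (-1) ^ (p + q : ℕ)) analyticAt_const).congr
      (.of_eq (funext fun v => ?_))
    rw [key, ← mul_assoc, ← pow_add, ← two_mul, pow_mul]
    simp

/-- Since `adj (X D Y) = adj Y * adj D * adj X`, the entries on the left are analytic combinations
of those of `adj D`. The reindexing by `e` makes the rectangular index types `a × b` square, as the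
adjugate requires. -/
theorem ComplexMem.adjugate_mul_mul {m : ℕ} {I : Ideal (AnalyticGerm m)} {a b : Type*} [Fintype a]
    [DecidableEq a] [Fintype b] [DecidableEq b] (e : b ≃ a) {N : (Fin m → ℝ) → Matrix a a ℂ}
    {X : (Fin m → ℝ) → Matrix a b ℂ} {D : (Fin m → ℝ) → Matrix b b ℂ}
    {Y : (Fin m → ℝ) → Matrix b a ℂ} (hX : ∀ i j, AnalyticAt ℝ (X · i j) 0)
    (hY : ∀ i j, AnalyticAt ℝ (Y · i j) 0) (hN : ∀ᶠ v in 𝓝 0, N v = X v * D v * Y v)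
    (hD : ∀ i j, ComplexMem I (fun v => (D v).adjugate i j)) (i j : a) :
    ComplexMem I (fun v => (N v).adjugate i j) := by
  have hX' := AnalyticAt.matrix_adjugate (A := fun v => (X v).submatrix e id)
    fun k l => hX (e k) l
  have hY' := AnalyticAt.matrix_adjugate (A := fun v => (Y v).submatrix id e)
    fun k l => hY k (e l)
  refine ComplexMem.congr (g := fun v => ∑ k, ((Y v).submatrix id e).adjugate (e.symm i) k *
    ∑ l, (D v).adjugate k l * ((X v).submatrix e id).adjugate l (e.symm j)) ?_ ?_
  · exact ComplexMem.sum _ fun k _ => (ComplexMem.sum _ fun l _ =>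
      (hD k l).mul_right (hX' _ _)).const_mul_left (hY' _ _)
  · filter_upwards [hN] with v hv
    have h1 : ((N v).submatrix e e) =
        (X v).submatrix e id * D v * (Y v).submatrix id e := by
      rw [hv]
      ext k l
      simp [Matrix.mul_apply]
    have h2 := congrArg Matrix.adjugate h1
    rw [adjugate_submatrix_equiv_self, adjugate_mul_distrib, adjugate_mul_distrib] at h2
    have h3 := congrFun (congrFun h2 (e.symm i)) (e.symm j)
    simpa [Matrix.mul_apply] using h3

/-- When `Q` is invertible at the origin, the entries of the adjugate of `diag(P, Q)` and the
entries of the `2 × 2` block `P` generate the same ideal. -/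
theorem ComplexMem.adjugate_fromBlocks_iff {m : ℕ} {I : Ideal (AnalyticGerm m)} {b : Type*}
    [Fintype b] [DecidableEq b] {P : (Fin m → ℝ) → Matrix (Fin 2) (Fin 2) ℂ}
    {Q : (Fin m → ℝ) → Matrix b b ℂ} (hP : ∀ i j, AnalyticAt ℝ (P · i j) 0)
    (hQ : ∀ i j, AnalyticAt ℝ (Q · i j) 0) (hQ0 : (Q 0).det ≠ 0) :
    (∀ i j, ComplexMem I (fun v => (fromBlocks (P v) 0 0 (Q v)).adjugate i j)) ↔
      ∀ i j, ComplexMem I (fun v => P v i j) := by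
  simp only [adjugate_fromBlocks_zero_zero]
  have hdet := AnalyticAt.matrix_det hQ
  constructor
  · intro h
    have hadj : ∀ i j, ComplexMem I (fun v => (P v).adjugate i j) := by
      intro i j
      -- The upper left block is `det Q • adj P`, and `det Q` is a unit in the ring of germs.
      refine ((h (Sum.inl i) (Sum.inl j)).const_mul_left (hdet.inv hQ0)).congr ?_
      filter_upwards [hdet.continuousAt.eventually_ne hQ0] with v hv
      simp [hv]
    simp only [adjugate_fin_two] at hadj
    have h00 : ComplexMem I (fun v => P v 1 1) := hadj 0 0
    have h11 : ComplexMem I (fun v => P v 0 0) := hadj 1 1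
    have h01 : ComplexMem I (fun v => - - P v 0 1) := (hadj 0 1).neg
    have h10 : ComplexMem I (fun v => - - P v 1 0) := (hadj 1 0).neg
    simp only [neg_neg] at h01 h10
    intro i j
    fin_cases i <;> fin_cases j
    exacts [h11, h01, h10, h00]
  · intro h
    have hdP : ComplexMem I (fun v => (P v).det) := by
      simp only [det_fin_two]
      exact ((h 1 1).const_mul_left (hP 0 0)).sub ((h 1 0).const_mul_left (hP 0 1))
    rintro (i | i) (j | j)
    · simp only [fromBlocks_apply₁₁, Matrix.smul_apply, smul_eq_mul]
      refine ComplexMem.const_mul_left hdet ?_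
      simp only [adjugate_fin_two]
      fin_cases i <;> fin_cases j
      exacts [h 1 1, (h 0 1).neg, (h 1 0).neg, h 0 0]
    · exact ComplexMem.zero
    · exact ComplexMem.zero
    · simp only [fromBlocks_apply₂₂, Matrix.smul_apply, smul_eq_mul]
      exact hdP.mul_right (AnalyticAt.matrix_adjugate hQ i j)

end MinorIdeal

/-! ### The Schrieffer–Wolff map and its local analytic inverse. -/

section SchriefferWolff

variable {a b : Type*}

/-- The block diagonal part of a block matrix. -/
def blockDiagPart : Matrix (a ⊕ b) (a ⊕ b) ℂ →ₗ[ℝ] Matrix (a ⊕ b) (a ⊕ b) ℂ where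
  toFun X := fromBlocks X.toBlocks₁₁ 0 0 X.toBlocks₂₂
  map_add' X Y := by ext (i | i) (j | j) <;> simp [toBlocks₁₁, toBlocks₂₂]
  map_smul' c X := by ext (i | i) (j | j) <;> simp [toBlocks₁₁, toBlocks₂₂]

/-- The block off-diagonal part of a block matrix. -/
def blockOffDiagPart : Matrix (a ⊕ b) (a ⊕ b) ℂ →ₗ[ℝ] Matrix (a ⊕ b) (a ⊕ b) ℂ where
  toFun X := fromBlocks 0 X.toBlocks₁₂ X.toBlocks₂₁ 0
  map_add' X Y := by ext (i | i) (j | j) <;> simp [toBlocks₁₂, toBlocks₂₁]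
  map_smul' c X := by ext (i | i) (j | j) <;> simp [toBlocks₁₂, toBlocks₂₁]

theorem blockDiagPart_apply (X : Matrix (a ⊕ b) (a ⊕ b) ℂ) :
    blockDiagPart X = fromBlocks X.toBlocks₁₁ 0 0 X.toBlocks₂₂ := rfl

theorem blockOffDiagPart_apply (X : Matrix (a ⊕ b) (a ⊕ b) ℂ) :
    blockOffDiagPart X = fromBlocks 0 X.toBlocks₁₂ X.toBlocks₂₁ 0 := rfl

/-- The involution that fixes a block matrix precisely when its diagonal part is Hermitian and its
off-diagonal part is anti-Hermitian. -/
def blockInvolution (X : Matrix (a ⊕ b) (a ⊕ b) ℂ) : Matrix (a ⊕ b) (a ⊕ b) ℂ :=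
  (blockDiagPart X)ᴴ - (blockOffDiagPart X)ᴴ

theorem blockDiagPart_blockInvolution (X : Matrix (a ⊕ b) (a ⊕ b) ℂ) :
    blockDiagPart (blockInvolution X) = (blockDiagPart X)ᴴ := by
  ext (i | i) (j | j) <;>
    simp [blockInvolution, blockDiagPart, blockOffDiagPart, toBlocks₁₁, toBlocks₂₂]

theorem blockOffDiagPart_blockInvolution (X : Matrix (a ⊕ b) (a ⊕ b) ℂ) :
    blockOffDiagPart (blockInvolution X) = -(blockOffDiagPart X)ᴴ := by
  ext (i | i) (j | j) <;>
    simp [blockInvolution, blockDiagPart, blockOffDiagPart, toBlocks₁₂, toBlocks₂₁]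

variable [Fintype a] [DecidableEq a] [Fintype b] [DecidableEq b]

/-- The Schrieffer–Wolff map in block form. -/
def blockSWMap (A X : Matrix (a ⊕ b) (a ⊕ b) ℂ) : Matrix (a ⊕ b) (a ⊕ b) ℂ :=
  NormedSpace.exp (blockOffDiagPart X) * (A + blockDiagPart X) *
    NormedSpace.exp (-blockOffDiagPart X)

theorem blockSWMap_zero (A : Matrix (a ⊕ b) (a ⊕ b) ℂ) : blockSWMap A 0 = A := by
  simp [blockSWMap]

/-- This equivariance is what later forces the solution of the decomposition of a Hermitian matrix
to be fixed by the involution. -/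
theorem conjTranspose_blockSWMap {A : Matrix (a ⊕ b) (a ⊕ b) ℂ} (hA : A.IsHermitian)
    (X : Matrix (a ⊕ b) (a ⊕ b) ℂ) :
    (blockSWMap A X)ᴴ = blockSWMap A (blockInvolution X) := by
  simp only [blockSWMap, blockDiagPart_blockInvolution, blockOffDiagPart_blockInvolution,
    conjTranspose_mul, conjTranspose_add, ← Matrix.exp_conjTranspose, hA.eq, conjTranspose_neg,
    neg_neg, Matrix.mul_assoc]

/-- The derivative of the Schrieffer–Wolff map at the origin. -/
def blockSWDeriv (A : Matrix (a ⊕ b) (a ⊕ b) ℂ) :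
    Matrix (a ⊕ b) (a ⊕ b) ℂ →ₗ[ℝ] Matrix (a ⊕ b) (a ⊕ b) ℂ :=
  blockDiagPart + (LinearMap.mulRight ℝ A ∘ₗ blockOffDiagPart -
    LinearMap.mulLeft ℝ A ∘ₗ blockOffDiagPart)

/-- The derivative is `D + [O, A]` for the diagonal and off-diagonal parts `D`, `O` of `X`. The
commutator is off-diagonal, with blocks `X₁₂ (B - lam)` and `-(B - lam) X₂₁`, so invertibility of `B
- lam` makes both parts recoverable. -/
theorem injective_blockSWDeriv {lam : ℂ} {B : Matrix b b ℂ} (hB : IsUnit (B - lam • 1)) :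
    Function.Injective (blockSWDeriv (fromBlocks (lam • (1 : Matrix a a ℂ)) 0 0 B)) := by
  rw [injective_iff_map_eq_zero]
  intro X hX
  have hX' : fromBlocks X.toBlocks₁₁ (X.toBlocks₁₂ * (B - lam • 1))
      (-((B - lam • 1) * X.toBlocks₂₁)) X.toBlocks₂₂ = 0 := by
    rw [← hX]
    simp only [blockSWDeriv, LinearMap.add_apply, LinearMap.sub_apply, LinearMap.comp_apply,
      LinearMap.mulRight_apply, LinearMap.mulLeft_apply, blockDiagPart_apply,
      blockOffDiagPart_apply, fromBlocks_multiply]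
    rw [sub_eq_add_neg (fromBlocks _ _ _ _), fromBlocks_neg, fromBlocks_add, fromBlocks_add]
    congr 1 <;> simp [Matrix.mul_add, Matrix.add_mul, sub_eq_add_neg, add_comm]
  rw [← fromBlocks_zero, fromBlocks_inj] at hX'
  obtain ⟨h11, h12, h21, h22⟩ := hX'
  obtain ⟨u, hu⟩ := hB
  have k12 : X.toBlocks₁₂ = 0 := by
    have h := congrArg (· * (↑u⁻¹ : Matrix b b ℂ)) h12
    simpa only [← hu, Matrix.mul_assoc, Units.mul_inv, Matrix.mul_one, Matrix.zero_mul] using h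
  have k21 : X.toBlocks₂₁ = 0 := by
    have h := congrArg ((↑u⁻¹ : Matrix b b ℂ) * ·) (neg_eq_zero.mp h21)
    simpa only [← hu, ← Matrix.mul_assoc, Units.inv_mul, Matrix.one_mul, Matrix.mul_zero] using h
  rw [← fromBlocks_toBlocks X, h11, k12, k21, h22, fromBlocks_zero]

section Norm

attribute [local instance] Matrix.linftyOpNormedAddCommGroup Matrix.linftyOpNormedRing
  Matrix.linftyOpNormedSpace Matrix.linftyOpNormedAlgebra

theorem analyticAt_blockSWMap (A X : Matrix (a ⊕ b) (a ⊕ b) ℂ) :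
    AnalyticAt ℝ (blockSWMap A) X := by
  have hO : AnalyticAt ℝ (fun X : Matrix (a ⊕ b) (a ⊕ b) ℂ => blockOffDiagPart X) X :=
    (LinearMap.toContinuousLinearMap blockOffDiagPart).analyticAt X
  have hD : AnalyticAt ℝ (fun X : Matrix (a ⊕ b) (a ⊕ b) ℂ => blockDiagPart X) X :=
    (LinearMap.toContinuousLinearMap blockDiagPart).analyticAt X
  exact (((NormedSpace.exp_analytic (𝕂 := ℝ) _).comp hO).mul (analyticAt_const.add hD)).mul
    ((NormedSpace.exp_analytic (𝕂 := ℝ) _).comp hO.neg)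

theorem hasStrictFDerivAt_blockSWMap (A : Matrix (a ⊕ b) (a ⊕ b) ℂ) :
    HasStrictFDerivAt (blockSWMap A) (LinearMap.toContinuousLinearMap (blockSWDeriv A)) 0 := by
  have hO := (LinearMap.toContinuousLinearMap (blockOffDiagPart (a := a) (b := b))).hasStrictFDerivAt
    (x := 0)
  have hD := (LinearMap.toContinuousLinearMap (blockDiagPart (a := a) (b := b))).hasStrictFDerivAt
    (x := 0)
  have hexp := hasStrictFDerivAt_exp_zero (𝕂 := ℝ) (𝔸 := Matrix (a ⊕ b) (a ⊕ b) ℂ)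
  have h1 := HasStrictFDerivAt.comp (g := NormedSpace.exp) 0 (by rw [map_zero]; exact hexp) hO
  have h2 := HasStrictFDerivAt.comp (g := NormedSpace.exp) 0
    (by rw [Pi.neg_apply, map_zero, neg_zero]; exact hexp) hO.neg
  have h3 := (h1.mul' (hD.const_add A)).mul' h2
  refine h3.congr_fderiv ?_
  ext1 X
  change NormedSpace.exp (blockOffDiagPart 0) * (A + blockDiagPart 0) * -blockOffDiagPart X +
    (NormedSpace.exp (blockOffDiagPart 0) * blockDiagPart X +
      blockOffDiagPart X * (A + blockDiagPart 0)) * NormedSpace.exp (-blockOffDiagPart 0) =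
    blockDiagPart X + (blockOffDiagPart X * A - A * blockOffDiagPart X)
  simp only [map_zero, neg_zero, NormedSpace.exp_zero, one_mul, mul_one, add_zero, mul_neg]
  abel

/-- The equation is solved among all matrices, with no symmetry imposed; `X` and its involute then
both solve it near zero, so they agree. -/
theorem exists_analytic_blockSWMap {E : Type*} [NormedAddCommGroup E] [NormedSpace ℝ E]
    {lam : ℂ} {B : Matrix b b ℂ} (hB : IsUnit (B - lam • 1)) {K : E → Matrix (a ⊕ b) (a ⊕ b) ℂ}
    (hK : ∀ i j, AnalyticAt ℝ (K · i j) 0) (hK0 : K 0 = fromBlocks (lam • 1) 0 0 B)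
    (hKH : ∀ᶠ x in 𝓝 0, (K x).IsHermitian) :
    ∃ X : E → Matrix (a ⊕ b) (a ⊕ b) ℂ, (∀ i j, AnalyticAt ℝ (X · i j) 0) ∧ X 0 = 0 ∧
      (∀ᶠ x in 𝓝 0, K x = blockSWMap (fromBlocks (lam • 1) 0 0 B) (X x)) ∧
      ∀ᶠ x in 𝓝 0, blockInvolution (X x) = X x := by
  set A : Matrix (a ⊕ b) (a ⊕ b) ℂ := fromBlocks (lam • 1) 0 0 B with hA
  have hAH : A.IsHermitian := hK0 ▸ hKH.self_of_nhds
  let L : Matrix (a ⊕ b) (a ⊕ b) ℂ ≃L[ℝ] Matrix (a ⊕ b) (a ⊕ b) ℂ :=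
    (LinearEquiv.ofInjectiveEndo _ (injective_blockSWDeriv (a := a) hB)).toContinuousLinearEquiv
  have hL : HasFDerivAt (blockSWMap A)
      (L : Matrix (a ⊕ b) (a ⊕ b) ℂ →L[ℝ] Matrix (a ⊕ b) (a ⊕ b) ℂ) 0 :=
    (hasStrictFDerivAt_blockSWMap A).hasFDerivAt
  -- The smoothness exponent `⊤` means analytic, so the local inverse obtained from it is analytic
  -- too.
  have hC : ContDiffAt ℝ ⊤ (blockSWMap A) 0 := (analyticAt_blockSWMap A 0).contDiffAt
  have hS : HasStrictFDerivAt (blockSWMap A)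
      (L : Matrix (a ⊕ b) (a ⊕ b) ℂ →L[ℝ] Matrix (a ⊕ b) (a ⊕ b) ℂ) 0 :=
    hasStrictFDerivAt_blockSWMap A
  let G := hS.localInverse (blockSWMap A) L 0
  have hGan : AnalyticAt ℝ G A := by
    have h : ContDiffAt ℝ ⊤ G (blockSWMap A 0) := hC.to_localInverse hL (by simp)
    rw [blockSWMap_zero] at h
    exact h.analyticAt
  have hG0 : G A = 0 := by
    have h := hS.localInverse_apply_image
    rwa [blockSWMap_zero] at h
  have hKan : AnalyticAt ℝ K 0 := AnalyticAt.of_matrix_entries hK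
  have hX : AnalyticAt ℝ (fun x => G (K x)) 0 := AnalyticAt.fun_comp (by rw [hK0]; exact hGan) hKan
  have hKt : Tendsto K (𝓝 0) (𝓝 A) := hK0 ▸ hKan.continuousAt.tendsto
  have hXt : Tendsto (fun x => G (K x)) (𝓝 0) (𝓝 0) := by
    have h := hX.continuousAt.tendsto
    rwa [hK0, hG0] at h
  have hright : ∀ᶠ x in 𝓝 0, blockSWMap A (G (K x)) = K x := by
    have h := hS.eventually_right_inverse
    rw [blockSWMap_zero] at h
    exact hKt.eventually h
  have hinv : Tendsto (blockInvolution : Matrix (a ⊕ b) (a ⊕ b) ℂ → _) (𝓝 0) (𝓝 0) := by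
    have hc : Continuous (blockInvolution : Matrix (a ⊕ b) (a ⊕ b) ℂ → _) := by
      have h1 := (LinearMap.toContinuousLinearMap (blockOffDiagPart (a := a) (b := b))).continuous
      have h2 := (LinearMap.toContinuousLinearMap (blockDiagPart (a := a) (b := b))).continuous
      exact h2.matrix_conjTranspose.sub h1.matrix_conjTranspose
    refine hc.tendsto' 0 0 ?_
    simp [blockInvolution]
  refine ⟨fun x => G (K x), fun i j => hX.matrix_entry i j, by simp only [hK0, hG0],
    hright.mono fun x hx => hx.symm, ?_⟩
  -- The left inverse property is applied at the involute of `X x`, which is also near zero; its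
  -- image under the map is `(K x)ᴴ = K x`.
  have hleft := hS.eventually_left_inverse
  filter_upwards [hright, hKH, (hinv.comp hXt).eventually hleft] with x h1 h2 h3
  rw [Function.comp_apply, ← conjTranspose_blockSWMap hAH, h1, h2.eq] at h3
  exact h3.symm

end Norm

end SchriefferWolff

/-! ### Splitting off the two-dimensional eigenspace. -/

section Diagonalization

/-- The spectral theorem for `A₀ - λ₀`: its rank `n - 2` counts the nonzero eigenvalues, so exactly
two indices carry the eigenvalue zero. -/
theorem exists_isPartialDiagonalization {n : ℕ} {A₀ : Matrix (Fin n) (Fin n) ℂ} {lam₀ : ℝ}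
    (hA : A₀.IsHermitian) (h2 : IsTwofoldEigenvalue A₀ lam₀) :
    ∃ G₀ B₀, IsPartialDiagonalization A₀ lam₀ G₀ B₀ := by
  set A : Matrix (Fin n) (Fin n) ℂ := A₀ - (lam₀ : ℂ) • 1 with hAdef
  have hAH : A.IsHermitian := by
    rw [hAdef, IsHermitian, conjTranspose_sub, hA.eq, conjTranspose_smul, conjTranspose_one]
    simp
  have hker : Module.finrank ℂ (LinearMap.ker (Matrix.toLin' A)) = 2 := by
    have hT : Matrix.toLin' A = Matrix.toLin' A₀ - (lam₀ : ℂ) • 1 := by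
      rw [hAdef, map_sub, map_smul, Matrix.toLin'_one]
      rfl
    rw [← h2, Module.End.eigenspace_def, hT]
  have hrank : A.rank + 2 = n := by
    have h := LinearMap.finrank_range_add_finrank_ker (Matrix.toLin' A)
    rw [hker] at h
    rwa [Module.finrank_fin_fun] at h
  have hcard := hAH.rank_eq_card_non_zero_eigs
  have hcard' : Fintype.card {i // ¬ hAH.eigenvalues i ≠ 0} = 2 := by
    rw [Fintype.card_subtype_compl, ← hcard, Fintype.card_fin]
    omega
  have e1 : Fin 2 ≃ {i // ¬ hAH.eigenvalues i ≠ 0} :=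
    Fintype.equivOfCardEq (by rw [hcard', Fintype.card_fin])
  have e2 : Fin (n - 2) ≃ {i // hAH.eigenvalues i ≠ 0} :=
    Fintype.equivOfCardEq (by rw [← hcard, Fintype.card_fin]; omega)
  -- `Equiv.sumCompl` lists the nonzero eigenvalues first; the swap moves the two zero ones to the
  -- first block.
  let e : Fin 2 ⊕ Fin (n - 2) ≃ Fin n :=
    (Equiv.sumComm _ _).trans ((Equiv.sumCongr e2 e1).trans (Equiv.sumCompl _))
  have he1 : ∀ i, hAH.eigenvalues (e (Sum.inl i)) = 0 := fun i => not_not.mp (e1 i).2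
  have he2 : ∀ i, hAH.eigenvalues (e (Sum.inr i)) ≠ 0 := fun i => (e2 i).2
  let U : Matrix (Fin n) (Fin n) ℂ := hAH.eigenvectorUnitary
  have hU1 : Uᴴ * U = 1 := Unitary.coe_star_mul_self hAH.eigenvectorUnitary
  have hU2 : U * Uᴴ = 1 := Unitary.coe_mul_star_self hAH.eigenvectorUnitary
  have hspec : Uᴴ * A * U = diagonal (fun i => (hAH.eigenvalues i : ℂ)) := by
    have h := hAH.conjStarAlgAut_star_eigenvectorUnitary
    rw [Unitary.conjStarAlgAut_star_apply] at h
    exact h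
  have hspec' : Uᴴ * A₀ * U = diagonal (fun i => (lam₀ : ℂ) + (hAH.eigenvalues i : ℂ)) := by
    have : A₀ = (lam₀ : ℂ) • 1 + A := by rw [hAdef]; abel
    rw [this, Matrix.mul_add, Matrix.add_mul, hspec, Matrix.mul_smul, Matrix.smul_mul,
      Matrix.mul_one, hU1]
    ext i j
    by_cases h : i = j <;> simp [h]
  refine ⟨U.submatrix id e, diagonal fun i => (lam₀ : ℂ) + (hAH.eigenvalues (e (Sum.inr i)) : ℂ),
    ?_, ?_, ?_, ?_⟩
  · have : (U.submatrix id e)ᴴ * U.submatrix id e = (Uᴴ * U).submatrix e e := rfl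
    rw [this, hU1, submatrix_one_equiv]
  · rw [conjTranspose_submatrix, submatrix_mul_equiv, hU2, submatrix_id_id]
  · have : (U.submatrix id e)ᴴ * A₀ * U.submatrix id e = (Uᴴ * A₀ * U).submatrix e e := rfl
    rw [this, hspec']
    ext (i | i) (j | j)
    · simp [diagonal_apply, one_apply, he1]
    · simp
    · simp
    · simp [diagonal_apply]
  · have : (diagonal fun i => (lam₀ : ℂ) + (hAH.eigenvalues (e (Sum.inr i)) : ℂ)) -
        (lam₀ : ℂ) • (1 : Matrix (Fin (n - 2)) (Fin (n - 2)) ℂ) =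
          diagonal fun i => (hAH.eigenvalues (e (Sum.inr i)) : ℂ) := by
      ext i j
      by_cases h : i = j <;> simp [h]
    rw [this, Matrix.isUnit_iff_isUnit_det, det_diagonal, isUnit_iff_ne_zero]
    exact Finset.prod_ne_zero_iff.mpr fun i _ => Complex.ofReal_ne_zero.mpr (he2 i)

end Diagonalization

/-! ### Existence of an effective germ. -/

section Existence

variable {n : ℕ} {H : (Fin 3 → ℝ) → Matrix (Fin n) (Fin n) ℂ} {lam₀ : ℝ}

theorem swMap_eq_blockSWMap (G₀ : Matrix (Fin n) (Fin 2 ⊕ Fin (n - 2)) ℂ)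
    (B₀ : Matrix (Fin (n - 2)) (Fin (n - 2)) ℂ)
    (X : Matrix (Fin 2 ⊕ Fin (n - 2)) (Fin 2 ⊕ Fin (n - 2)) ℂ) :
    swMap lam₀ G₀ B₀ X.toBlocks₁₂ X.toBlocks₂₁ X.toBlocks₂₂ X.toBlocks₁₁ =
      G₀ * blockSWMap (fromBlocks ((lam₀ : ℂ) • 1) 0 0 B₀) X * G₀ᴴ := by
  have h : fromBlocks ((lam₀ : ℂ) • (1 : Matrix (Fin 2) (Fin 2) ℂ)) 0 0 B₀ +
      fromBlocks 0 0 0 X.toBlocks₂₂ + fromBlocks X.toBlocks₁₁ 0 0 0 =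
        fromBlocks ((lam₀ : ℂ) • 1) 0 0 B₀ + blockDiagPart X := by
    rw [add_assoc, fromBlocks_add, blockDiagPart_apply]
    simp
  rw [swMap, h, blockSWMap, blockOffDiagPart_apply]
  simp only [Matrix.mul_assoc]

theorem exists_isSWDecomposition (hH : IsHamiltonianGerm H)
    (hlam₀ : IsTwofoldEigenvalue (H 0) lam₀) :
    ∃ G₀ B₀ S₁₂ S₂₁ C₂₂ E, IsSWDecomposition H lam₀ G₀ B₀ S₁₂ S₂₁ C₂₂ E := by
  obtain ⟨G₀, B₀, hG⟩ := exists_isPartialDiagonalization hH.isHermitian.self_of_nhds hlam₀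
  obtain ⟨X, hXan, hX0, hXdec, hXinv⟩ := exists_analytic_blockSWMap (a := Fin 2) hG.isUnit
    (K := fun x => G₀ᴴ * H x * G₀)
    (AnalyticAt.matrix_mul (AnalyticAt.matrix_mul (fun _ _ => analyticAt_const) hH.analyticAt)
      fun _ _ => analyticAt_const)
    hG.normalForm
    (hH.isHermitian.mono fun x hx => by
      rw [IsHermitian, conjTranspose_mul, conjTranspose_mul, conjTranspose_conjTranspose, hx.eq,
        Matrix.mul_assoc])
  have hz : ∀ i j, X 0 i j = 0 := fun i j => by rw [hX0]; rfl
  refine ⟨G₀, B₀, fun x => (X x).toBlocks₁₂, fun x => (X x).toBlocks₂₁,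
    fun x => (X x).toBlocks₂₂, fun x => (X x).toBlocks₁₁,
    { diag := hG
      analyticAt_S₁₂ := fun i j => hXan _ _
      analyticAt_S₂₁ := fun i j => hXan _ _
      analyticAt_C₂₂ := fun i j => hXan _ _
      analyticAt_E := fun i j => hXan _ _
      S₁₂_zero := Matrix.ext fun i j => hz _ _
      S₂₁_zero := Matrix.ext fun i j => hz _ _
      C₂₂_zero := Matrix.ext fun i j => hz _ _
      E_zero := Matrix.ext fun i j => hz _ _
      antiHermitian := ?_
      isHermitian_C₂₂ := ?_
      isHermitian_E := ?_
      decomposition := ?_ }⟩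
  · filter_upwards [hXinv] with x hx
    ext i j
    have h := congrFun (congrFun hx (Sum.inl i)) (Sum.inr j)
    simpa [blockInvolution, blockDiagPart_apply, blockOffDiagPart_apply, toBlocks₁₂, toBlocks₂₁]
      using h.symm
  · filter_upwards [hXinv] with x hx
    ext i j
    have h := congrFun (congrFun hx (Sum.inr i)) (Sum.inr j)
    simpa [blockInvolution, blockDiagPart_apply, blockOffDiagPart_apply, toBlocks₂₂] using h
  · filter_upwards [hXinv] with x hx
    ext i j
    have h := congrFun (congrFun hx (Sum.inl i)) (Sum.inl j)
    simpa [blockInvolution, blockDiagPart_apply, blockOffDiagPart_apply, toBlocks₁₁] using h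
  · filter_upwards [hXdec] with x hx
    rw [swMap_eq_blockSWMap, ← hx]
    simp only [← Matrix.mul_assoc, hG.mul_conjTranspose_self, Matrix.one_mul]
    rw [Matrix.mul_assoc, hG.mul_conjTranspose_self, Matrix.mul_one]

theorem tracelessPart_mem {E : Matrix (Fin 2) (Fin 2) ℂ} (hE : E.IsHermitian) :
    tracelessPart E ∈ tracelessHermitian := by
  have htr : star E.trace = E.trace := by rw [← trace_conjTranspose, hE.eq]
  constructor
  · rw [tracelessPart, IsHermitian, conjTranspose_sub, hE.eq, conjTranspose_smul,
      conjTranspose_one, star_div₀, htr]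
    simp
  · rw [tracelessPart, trace_sub, trace_smul, trace_one]
    simp

/-- The coordinates of a traceless Hermitian `2 × 2` matrix with respect to the Pauli matrices. -/
def pauliEquiv : tracelessHermitian ≃ₗ[ℝ] (Fin 3 → ℝ) where
  toFun A := ![(A.1 0 0).re, (A.1 0 1).re, (A.1 0 1).im]
  map_add' A B := by ext i; fin_cases i <;> simp
  map_smul' c A := by ext i; fin_cases i <;> simp
  invFun v := ⟨!![(v 0 : ℂ), v 1 + v 2 * Complex.I; v 1 - v 2 * Complex.I, -(v 0 : ℂ)], by
    constructor
    · ext i j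
      fin_cases i <;> fin_cases j <;> simp [sub_eq_add_neg]
    · simp [trace_fin_two]⟩
  left_inv A := by
    obtain ⟨A, hA, ht⟩ := A
    have h00 := hA.apply 0 0
    have h01 := hA.apply 1 0
    have h00i := congrArg Complex.im h00
    have h01r := congrArg Complex.re h01
    have h01i := congrArg Complex.im h01
    rw [trace_fin_two] at ht
    have htr := congrArg Complex.re ht
    have hti := congrArg Complex.im ht
    simp at h00i h01r h01i htr hti
    apply Subtype.ext
    ext i j
    fin_cases i <;> fin_cases j <;> apply Complex.ext <;> simp <;> linarith
  right_inv v := by ext i; fin_cases i <;> simp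

theorem exists_isEffectiveGerm (hH : IsHamiltonianGerm H)
    (hlam₀ : IsTwofoldEigenvalue (H 0) lam₀) :
    ∃ h : (Fin 3 → ℝ) → (Fin 3 → ℝ), IsEffectiveGerm H lam₀ h := by
  obtain ⟨G₀, B₀, S₁₂, S₂₁, C₂₂, E, hdec⟩ := exists_isSWDecomposition hH hlam₀
  have hE := hdec.analyticAt_E
  have hT : ∀ i j, AnalyticAt ℝ (fun x => tracelessPart (E x) i j) 0 := by
    intro i j
    simp only [tracelessPart, trace_fin_two, Matrix.sub_apply, Matrix.smul_apply, smul_eq_mul]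
    exact (hE i j).sub ((((hE 0 0).add (hE 1 1)).div analyticAt_const two_ne_zero).mul
      analyticAt_const)
  refine ⟨fun x => ![(tracelessPart (E x) 0 0).re, (tracelessPart (E x) 0 1).re,
    (tracelessPart (E x) 0 1).im], ?_, G₀, B₀, S₁₂, S₂₁, C₂₂, E, hdec,
    Module.Basis.ofEquivFun pauliEquiv, ?_⟩
  · intro i
    fin_cases i
    exacts [(hT 0 0).complex_re, (hT 0 1).complex_re, (hT 0 1).complex_im]
  · filter_upwards [hdec.isHermitian_E] with x hx
    have h := (Module.Basis.ofEquivFun pauliEquiv).sum_equivFun ⟨_, tracelessPart_mem hx⟩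
    have h' := congrArg Subtype.val h
    rw [AddSubmonoidClass.coe_finsetSum] at h'
    simp only [Submodule.coe_smul] at h'
    exact h'.symm

end Existence

/-! ### Comparing the ideal of minors with the ideal of the effective germ. -/

section Comparison

variable {n : ℕ} {H : (Fin 3 → ℝ) → Matrix (Fin n) (Fin n) ℂ} {lam₀ : ℝ}
  {G₀ : Matrix (Fin n) (Fin 2 ⊕ Fin (n - 2)) ℂ} {B₀ : Matrix (Fin (n - 2)) (Fin (n - 2)) ℂ}
  {S₁₂ : (Fin 3 → ℝ) → Matrix (Fin 2) (Fin (n - 2)) ℂ}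
  {S₂₁ : (Fin 3 → ℝ) → Matrix (Fin (n - 2)) (Fin 2) ℂ}
  {C₂₂ : (Fin 3 → ℝ) → Matrix (Fin (n - 2)) (Fin (n - 2)) ℂ}
  {E : (Fin 3 → ℝ) → Matrix (Fin 2) (Fin 2) ℂ}

theorem AnalyticAt.comp_init {F : Type*} [NormedAddCommGroup F] [NormedSpace ℝ F] {m : ℕ}
    {f : (Fin m → ℝ) → F} (hf : AnalyticAt ℝ f 0) :
    AnalyticAt ℝ (fun v : Fin (m + 1) → ℝ => f (Fin.init v)) 0 :=
  AnalyticAt.fun_comp (by rw [fin_init_zero]; exact hf) (analyticAt_fin_init 0)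

theorem tendsto_fin_init_zero (m : ℕ) :
    Tendsto (fun v : Fin (m + 1) → ℝ => (Fin.init v : Fin m → ℝ)) (𝓝 0) (𝓝 0) :=
  (analyticAt_fin_init 0).continuousAt.tendsto

theorem two_le_of_isTwofoldEigenvalue {A₀ : Matrix (Fin n) (Fin n) ℂ}
    (h : IsTwofoldEigenvalue A₀ lam₀) : 2 ≤ n := by
  have h' := Submodule.finrank_le (Module.End.eigenspace (Matrix.toLin' A₀) (lam₀ : ℂ))
  rwa [h, Module.finrank_fin_fun] at h'

/-- The `(n-1) × (n-1)` minors of `H - (λ₀ + λ) 𝟙` generate the same ideal as the entries of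
`E - λ 𝟙`. -/
theorem IsSWDecomposition.minorIdeal_le_iff (hdec : IsSWDecomposition H lam₀ G₀ B₀ S₁₂ S₂₁ C₂₂ E)
    (hH : IsHamiltonianGerm H) (hn : 2 ≤ n) (I : Ideal (AnalyticGerm 4)) :
    minorIdeal H hH lam₀ ≤ I ↔
      ∀ i j, ComplexMem I (fun v : Fin 4 → ℝ =>
        (E (Fin.init v) - ((v (Fin.last 3) : ℝ) : ℂ) • 1) i j) := by
  have hlast : AnalyticAt ℝ (fun v : Fin 4 → ℝ => ((v (Fin.last 3) : ℝ) : ℂ)) 0 :=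
    (analyticAt_eval _ _).complex_ofReal
  let S : (Fin 3 → ℝ) → Matrix (Fin 2 ⊕ Fin (n - 2)) (Fin 2 ⊕ Fin (n - 2)) ℂ :=
    fun x => fromBlocks 0 (S₁₂ x) (S₂₁ x) 0
  let P : (Fin 4 → ℝ) → Matrix (Fin 2) (Fin 2) ℂ :=
    fun v => E (Fin.init v) - ((v (Fin.last 3) : ℝ) : ℂ) • 1
  let Q : (Fin 4 → ℝ) → Matrix (Fin (n - 2)) (Fin (n - 2)) ℂ :=
    fun v => B₀ + C₂₂ (Fin.init v) - ((lam₀ + v (Fin.last 3) : ℝ) : ℂ) • 1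
  let U : (Fin 4 → ℝ) → Matrix (Fin n) (Fin 2 ⊕ Fin (n - 2)) ℂ :=
    fun v => G₀ * NormedSpace.exp (S (Fin.init v))
  let W : (Fin 4 → ℝ) → Matrix (Fin 2 ⊕ Fin (n - 2)) (Fin n) ℂ :=
    fun v => NormedSpace.exp (-S (Fin.init v)) * G₀ᴴ
  have hS : ∀ i j, AnalyticAt ℝ (S · i j) 0 := by
    rintro (i | i) (j | j)
    exacts [analyticAt_const, hdec.analyticAt_S₁₂ i j, hdec.analyticAt_S₂₁ i j, analyticAt_const]
  have hU : ∀ i j, AnalyticAt ℝ (U · i j) 0 :=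
    AnalyticAt.matrix_mul (fun _ _ => analyticAt_const)
      fun i j => (AnalyticAt.matrix_exp hS i j).comp_init
  have hW : ∀ i j, AnalyticAt ℝ (W · i j) 0 :=
    AnalyticAt.matrix_mul
      (fun i j => (AnalyticAt.matrix_exp (A := fun x => -S x) (fun i j => (hS i j).neg) i j).comp_init)
      fun _ _ => analyticAt_const
  have hP : ∀ i j, AnalyticAt ℝ (P · i j) 0 := fun i j =>
    (hdec.analyticAt_E i j).comp_init.sub (hlast.mul analyticAt_const)
  have hQ : ∀ i j, AnalyticAt ℝ (Q · i j) 0 := fun i j =>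
    (analyticAt_const.add (hdec.analyticAt_C₂₂ i j).comp_init).sub
      ((analyticAt_const.add (analyticAt_eval _ _)).complex_ofReal.mul analyticAt_const)
  have hQ0 : (Q 0).det ≠ 0 := by
    have : Q 0 = B₀ - (lam₀ : ℂ) • 1 := by
      simp only [Q, fin_init_zero, hdec.C₂₂_zero, Pi.zero_apply, add_zero]
    rw [this, ← isUnit_iff_ne_zero, ← Matrix.isUnit_iff_isUnit_det]
    exact hdec.diag.isUnit
  have hexp1 : ∀ A : Matrix (Fin 2 ⊕ Fin (n - 2)) (Fin 2 ⊕ Fin (n - 2)) ℂ,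
      NormedSpace.exp A * NormedSpace.exp (-A) = 1 := fun A => by
    rw [← Matrix.exp_add_of_commute _ _ (Commute.refl A).neg_right, add_neg_cancel,
      NormedSpace.exp_zero]
  have hUW : ∀ v, U v * W v = 1 := fun v => by
    simp only [U, W]
    rw [Matrix.mul_assoc, ← Matrix.mul_assoc (NormedSpace.exp _), hexp1, Matrix.one_mul,
      hdec.diag.mul_conjTranspose_self]
  have hWU : ∀ v, W v * U v = 1 := fun v => by
    have h := hexp1 (-S (Fin.init v))
    rw [neg_neg] at h
    simp only [U, W]
    rw [Matrix.mul_assoc, ← Matrix.mul_assoc G₀ᴴ, hdec.diag.conjTranspose_mul_self,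
      Matrix.one_mul, h]
  have hM : ∀ᶠ v in 𝓝 0, shiftedFamily H lam₀ v = U v * fromBlocks (P v) 0 0 (Q v) * W v := by
    filter_upwards [(tendsto_fin_init_zero 3).eventually hdec.decomposition] with v hv
    have hD : fromBlocks (P v) 0 0 (Q v) =
        (fromBlocks ((lam₀ : ℂ) • 1) 0 0 B₀ + fromBlocks 0 0 0 (C₂₂ (Fin.init v)) +
          fromBlocks (E (Fin.init v)) 0 0 0) - ((lam₀ + v (Fin.last 3) : ℝ) : ℂ) • 1 := by
      rw [← fromBlocks_one, fromBlocks_smul, sub_eq_add_neg, fromBlocks_neg, fromBlocks_add,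
        fromBlocks_add, fromBlocks_add]
      congr 1
      · simp only [P, Complex.ofReal_add, add_smul]
        abel
      · simp
      · simp
      · simp only [Q]
        abel
    rw [hD, Matrix.mul_sub, Matrix.sub_mul, Matrix.mul_smul, Matrix.smul_mul, Matrix.mul_one, hUW,
      shiftedFamily, hv, swMap]
    simp only [U, W, S, Matrix.mul_assoc]
  -- Each factorization transfers membership of adjugate entries one way only, so the inverse one is
  -- needed as well.
  have hD : ∀ᶠ v in 𝓝 0, fromBlocks (P v) 0 0 (Q v) = W v * shiftedFamily H lam₀ v * U v := by
    filter_upwards [hM] with v hv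
    calc fromBlocks (P v) 0 0 (Q v)
        = (W v * U v) * fromBlocks (P v) 0 0 (Q v) * (W v * U v) := by
          rw [hWU, Matrix.one_mul, Matrix.mul_one]
      _ = W v * shiftedFamily H lam₀ v * U v := by simp only [hv, Matrix.mul_assoc]
  have e : Fin 2 ⊕ Fin (n - 2) ≃ Fin n :=
    finSumFinEquiv.trans (finCongr (by omega))
  rw [minorIdeal_le_iff_adjugate (by omega), ← ComplexMem.adjugate_fromBlocks_iff hP hQ hQ0]
  exact ⟨fun h => ComplexMem.adjugate_mul_mul e.symm hW hU hD h,
    fun h => ComplexMem.adjugate_mul_mul e hU hW hM h⟩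

/-- This supplies the function whose graph eliminates `λ`. As `E` is Hermitian only near the origin,
the real part is taken globally and compared with the trace locally. -/
theorem exists_real_trace_germ (hdec : IsSWDecomposition H lam₀ G₀ B₀ S₁₂ S₂₁ C₂₂ E) :
    ∃ t : (Fin 3 → ℝ) → ℝ, AnalyticAt ℝ t 0 ∧ t 0 = 0 ∧
      ∀ᶠ x in 𝓝 0, (E x).trace / 2 = (t x : ℂ) := by
  have hE := hdec.analyticAt_E
  refine ⟨fun x => ((E x).trace / 2).re, ?_, by simp [hdec.E_zero], ?_⟩
  · simp only [trace_fin_two]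
    exact (((hE 0 0).add (hE 1 1)).div analyticAt_const two_ne_zero).complex_re
  · filter_upwards [hdec.isHermitian_E] with x hx
    have htr : star (E x).trace = (E x).trace := by rw [← trace_conjTranspose, hx.eq]
    refine (Complex.conj_eq_iff_re.mp ?_).symm
    rw [map_div₀, map_ofNat, starRingEnd_apply, htr]

/-- A real linear functional of the entries of a matrix with entries in the complexification of
`I` has values in `I`. -/
theorem ComplexMem.linearMap_apply {m : ℕ} {I : Ideal (AnalyticGerm m)}
    {A : (Fin m → ℝ) → Matrix (Fin 2) (Fin 2) ℂ} (hA : ∀ i j, ComplexMem I (A · i j))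
    (l : Matrix (Fin 2) (Fin 2) ℂ →ₗ[ℝ] ℝ) : ComplexMem I (fun v => ((l (A v) : ℝ) : ℂ)) := by
  -- As `l` is only real linear, its values on `single i j 1` and `single i j I` are independent
  -- data.
  have hl : ∀ v, ((l (A v) : ℝ) : ℂ) = ∑ i, ∑ j,
      (((l (single i j 1) : ℝ) : ℂ) * (((A v i j).re : ℝ) : ℂ) +
        ((l (single i j Complex.I) : ℝ) : ℂ) * (((A v i j).im : ℝ) : ℂ)) := by
    intro v
    have hs : ∀ (i j : Fin 2) (z : ℂ), single i j z =
        z.re • single i j (1 : ℂ) + z.im • single i j Complex.I := by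
      intro i j z
      rw [smul_single, smul_single, ← single_add]
      congr 1
      apply Complex.ext <;> simp
    conv_lhs => rw [matrix_eq_sum_single (A v)]
    simp only [map_sum, hs _ _ (A v _ _), map_add, map_smul, smul_eq_mul]
    push_cast
    refine Finset.sum_congr rfl fun i _ => Finset.sum_congr rfl fun j _ => ?_
    ring
  refine ComplexMem.congr ?_ (.of_eq (funext hl))
  exact ComplexMem.sum _ fun i _ => ComplexMem.sum _ fun j _ =>
    ((ComplexMem.ofReal (hA i j).1.2).const_mul_left analyticAt_const).add
      ((ComplexMem.ofReal (hA i j).2.2).const_mul_left analyticAt_const)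

theorem IsSWDecomposition.minorIdeal_eq (hdec : IsSWDecomposition H lam₀ G₀ B₀ S₁₂ S₂₁ C₂₂ E)
    (hH : IsHamiltonianGerm H) (hn : 2 ≤ n) {t : (Fin 3 → ℝ) → ℝ} (ht : AnalyticAt ℝ t 0)
    (htr : ∀ᶠ x in 𝓝 0, (E x).trace / 2 = (t x : ℂ)) {h : (Fin 3 → ℝ) → (Fin 3 → ℝ)}
    (hh : ∀ i, AnalyticAt ℝ (fun x => h x i) 0) (b : Module.Basis (Fin 3) ℝ tracelessHermitian)
    (hb : ∀ᶠ x in 𝓝 0, tracelessPart (E x) = ∑ i, h x i • (b i : Matrix (Fin 2) (Fin 2) ℂ)) :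
    minorIdeal H hH lam₀ = Ideal.span {AnalyticGerm.mk _ (analyticAt_last_sub ht)} ⊔
      (componentIdeal h hh).map (pullback Fin.init (analyticAt_fin_init 0) fin_init_zero) := by
  have hinit := tendsto_fin_init_zero 3
  apply le_antisymm
  · rw [hdec.minorIdeal_le_iff hH hn]
    set K := Ideal.span {AnalyticGerm.mk _ (analyticAt_last_sub ht)} ⊔
      (componentIdeal h hh).map (pullback Fin.init (analyticAt_fin_init 0) fin_init_zero)
    have hlam : ComplexMem K (fun v => ((v (Fin.last 3) - t (Fin.init v) : ℝ) : ℂ)) :=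
      ComplexMem.ofReal (hf := analyticAt_last_sub ht)
        (Ideal.mem_sup_left (Ideal.mem_span_singleton_self _))
    have hhK : ∀ i, ComplexMem K (fun v => ((h (Fin.init v) i : ℝ) : ℂ)) := fun i =>
      ComplexMem.ofReal (hf := (hh i).comp_init) (Ideal.mem_sup_right
        (Ideal.mem_map_of_mem (pullback Fin.init (analyticAt_fin_init 0) fin_init_zero)
          (Ideal.subset_span (Set.mem_range_self i) :
            AnalyticGerm.mk _ (hh i) ∈ componentIdeal h hh)))
    intro i j
    refine ComplexMem.congr (g := fun v =>
      (∑ k, ((h (Fin.init v) k : ℝ) : ℂ) * (b k : Matrix (Fin 2) (Fin 2) ℂ) i j) -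
        ((v (Fin.last 3) - t (Fin.init v) : ℝ) : ℂ) * (1 : Matrix (Fin 2) (Fin 2) ℂ) i j) ?_ ?_
    · exact (ComplexMem.sum _ fun k _ => (hhK k).mul_right analyticAt_const).sub
        (hlam.mul_right analyticAt_const)
    · filter_upwards [hinit.eventually htr, hinit.eventually hb] with v h1 h2
      have h3 := congrFun (congrFun h2 i) j
      simp only [tracelessPart, Matrix.sub_apply, Matrix.smul_apply, Matrix.sum_apply, smul_eq_mul,
        Complex.real_smul, h1] at h3
      rw [← h3]
      simp only [Matrix.sub_apply, Matrix.smul_apply, smul_eq_mul, Complex.ofReal_sub]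
      ring
  · have hP := (hdec.minorIdeal_le_iff hH hn _).mp le_rfl
    set J := minorIdeal H hH lam₀
    refine sup_le ?_ ?_
    · rw [Ideal.span_singleton_le_iff_mem]
      have h1 : ComplexMem J (fun v => ((v (Fin.last 3) - t (Fin.init v) : ℝ) : ℂ)) := by
        -- The trace of `E - λ` is `-2 (λ - t)`.
        refine (((hP 0 0).add (hP 1 1)).const_mul_left (c := fun _ => -1 / 2)
          analyticAt_const).congr ?_
        filter_upwards [hinit.eventually htr] with v hv
        rw [Complex.ofReal_sub, ← hv, trace_fin_two]
        simp
        ring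
      exact h1.1.2
    · rw [componentIdeal, Ideal.map_span, Ideal.span_le]
      rintro _ ⟨_, ⟨k, rfl⟩, rfl⟩
      have hT : ∀ i j, ComplexMem J (fun v => tracelessPart (E (Fin.init v)) i j) := by
        intro i j
        refine ((hP i j).sub (((((hP 0 0).add (hP 1 1)).const_mul_left (c := fun _ => 1 / 2)
          analyticAt_const).mul_right (c := fun _ => (1 : Matrix (Fin 2) (Fin 2) ℂ) i j))
            analyticAt_const)).congr (.of_eq (funext fun v => ?_))
        simp [tracelessPart, trace_fin_two]
        ring
      -- The `k`-th coordinate is defined only on traceless Hermitian matrices; a real linear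
      -- extension to all 2 × 2 matrices expresses `h k` through the matrix entries.
      obtain ⟨l, hl⟩ := LinearMap.exists_extend (b.coord k)
      have hlb : ∀ i, l (b i) = if i = k then 1 else 0 := fun i => by
        have := LinearMap.congr_fun hl (b i)
        simp only [LinearMap.comp_apply, Submodule.subtype_apply] at this
        rw [this, Module.Basis.coord_apply, Module.Basis.repr_self, Finsupp.single_apply]
      have h1 : ComplexMem J (fun v => ((h (Fin.init v) k : ℝ) : ℂ)) := by
        refine (ComplexMem.linearMap_apply hT l).congr ?_
        filter_upwards [hinit.eventually hb] with v hv
        rw [hv]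
        simp [hlb]
      exact h1.1.2

end Comparison

end

theorem mainTheorem12 (n : ℕ) (H : (Fin 3 → ℝ) → Matrix (Fin n) (Fin n) ℂ)
    (hH : IsHamiltonianGerm H) (lam₀ : ℝ) (hlam₀ : IsTwofoldEigenvalue (H 0) lam₀) :
    (∃ h : (Fin 3 → ℝ) → (Fin 3 → ℝ), IsEffectiveGerm H lam₀ h) ∧
    ∀ (h : (Fin 3 → ℝ) → (Fin 3 → ℝ)) (hh : IsEffectiveGerm H lam₀ h),
      Nonempty ((AnalyticGerm 4 ⧸ minorIdeal H hH lam₀) ≃ₐ[ℝ] LocalAlgebra h hh.analyticAt) := by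
  refine ⟨exists_isEffectiveGerm hH hlam₀, fun h hh => ?_⟩
  obtain ⟨G₀, B₀, S₁₂, S₂₁, C₂₂, E, hdec, b, hb⟩ := hh.exists_decomposition
  obtain ⟨t, ht, ht0, htr⟩ := exists_real_trace_germ hdec
  exact ⟨(Ideal.quotientEquivAlgOfEq ℝ (hdec.minorIdeal_eq hH (two_le_of_isTwofoldEigenvalue hlam₀)
    ht htr hh.analyticAt b hb)).trans (AnalyticGerm.quotientGraphEquiv ht ht0 _)⟩
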